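/- Let $n\ge 1$ be an odd integer, let $U\subseteq\mathbb{R}^n$ be open and let $a\in\mathbb{Z}$; if $n=1$, assume moreover that $a<-1$. For $m\in\mathbb{C}$ let $S^m(U)$ be the set of $\sigma\in C^\infty(U\times\mathbb{R}^n,\mathbb{C})$ such that for every compact $K\subset U$ and all multiindices $\alpha,\beta\in\mathbb{N}^n$ there is a constant $C$ with $$|\partial_x^\alpha\partial_\xi^\beta\sigma(x,\xi)|\le C(1+|\xi|)^{\Re(m)-|\beta|}\qquad\text{for all }(x,\xi)\in K\times\mathbb{R}^n,$$ and let $S^{-\infty}(U)=\bigcap_{m\in\mathbb{C}}S^m(U)$ be the space of smoothing symbols. For $b\in\mathbb{Z}$ let $CS^b_{\mathrm{odd}}(U)$ be the set of odd-class symbols of order $b$, that is, of those $\sigma\in S^b(U)$ for which there are functions $\sigma_{b-j}\in C^\infty(U\times(\mathbb{R}^n\setminus\{0\}),\mathbb{C})$, $j=0,1,2,\dots$, with $\sigma_{b-j}(x,t\xi)=t^{b-j}\sigma_{b-j}(x,\xi)$ for all $t>0$, $\xi\ne0$, with $\sigma_{b-j}(x,-\xi)=(-1)^{b-j}\sigma_{b-j}(x,\xi)$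 for all $|\xi|\ge1$, and such that $\sigma\sim\sum_{j\ge0}\psi\,\sigma_{b-j}$, i.e. $\psi\sigma_{b-j}\in S^{b-j}(U)$ for every $j\ge0$ and $$\sigma-\sum_{j=0}^{N-1}\psi\,\sigma_{b-j}\in S^{b-N}(U)\qquad\text{for every }N\in\mathbb{N},$$ for any cut-off function $\psi\in C^\infty(\mathbb{R}^n)$ (depending on $\xi$ only) that vanishes for $|\xi|\le\frac12$ and equals $1$ for $|\xi|\ge1$. Then for every $\sigma\in CS^a_{\mathrm{odd}}(U)$ there exist $\tau_1,\dots,\tau_n\in CS^{a+1}_{\mathrm{odd}}(U)$ such that $$\sigma-\sum_{i=1}^n\partial_{\xi_i}\tau_i\in S^{-\infty}(U).$$ -/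

import Mathlib

open scoped ContDiff

namespace OddClassSymbol

noncomputable section

/-- The Euclidean space `ℝⁿ`. -/
abbrev E (n : ℕ) : Type := EuclideanSpace ℝ (Fin n)

/-- The partial derivative `∂_{x_i}` of a function of `(x, ξ)`. -/
def partialX {n : ℕ} (i : Fin n) (f : E n × E n → ℂ) : E n × E n → ℂ :=
  fun p => fderiv ℝ f p (EuclideanSpace.single i 1, 0)

/-- The partial derivative `∂_{ξ_i}` of a function of `(x, ξ)`. -/
def partialXi {n : ℕ} (i : Fin n) (f : E n × E n → ℂ) : E n × E n → ℂ :=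
  fun p => fderiv ℝ f p (0, EuclideanSpace.single i 1)

/-- The iterated derivative `∂_{x_{i₁}} ⋯ ∂_{x_{i_k}}` for a word `α = [i₁, …, i_k]`. On smooth
functions it depends only on the multiindex that counts the letters of `α`, and every multiindex
arises in this way; its length is the length of the word. -/
def iterX {n : ℕ} (α : List (Fin n)) (f : E n × E n → ℂ) : E n × E n → ℂ :=
  α.foldr partialX f

/-- The iterated derivative `∂_{ξ_{i₁}} ⋯ ∂_{ξ_{i_k}}` for a word `β = [i₁, …, i_k]`. -/
def iterXi {n : ℕ} (β : List (Fin n)) (f : E n × E n → ℂ) : E n × E n → ℂ :=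
  β.foldr partialXi f

/-- `σ ∈ S^a(U)`: smooth on `U × ℝⁿ`, with the symbol estimates of order `a`, locally uniformly
in `x ∈ U`. Values of `σ` at points `(x, ξ)` with `x ∉ U` play no role when `U` is open. -/
structure IsSymbol {n : ℕ} (U : Set (E n)) (a : ℂ) (σ : E n × E n → ℂ) : Prop where
  smooth : ContDiffOn ℝ ∞ σ (U ×ˢ Set.univ)
  bound : ∀ K : Set (E n), IsCompact K → K ⊆ U → ∀ α β : List (Fin n),
    ∃ C : ℝ, ∀ x ∈ K, ∀ ξ : E n,
      ‖iterX α (iterXi β σ) (x, ξ)‖ ≤ C * (1 + ‖ξ‖) ^ (a.re - (β.length : ℝ))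

/-- The smoothing symbols `S^{-∞}(U) = ⋂_{a ∈ ℂ} S^a(U)`. -/
def IsSmoothing {n : ℕ} (U : Set (E n)) (σ : E n × E n → ℂ) : Prop :=
  ∀ a : ℂ, IsSymbol U a σ

/-- `σ ∼ ∑_j s_j`, where `s_j ∈ S^{m_j}(U)` and `m_j → -∞`. -/
structure HasAsymptoticExpansion {n : ℕ} (U : Set (E n)) (m : ℕ → ℂ)
    (σ : E n × E n → ℂ) (s : ℕ → E n × E n → ℂ) : Prop where
  order_tendsto : Filter.Tendsto (fun j => (m j).re) Filter.atTop Filter.atBot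
  term : ∀ j, IsSymbol U (m j) (s j)
  remainder : ∀ N : ℕ, IsSymbol U (m N) (fun p => σ p - ∑ j ∈ Finset.range N, s j p)

/-- Smooth cut-off functions that vanish for `|ξ| ≤ 1/2` and equal `1` for `|ξ| ≥ 1`. -/
structure IsCutoff {n : ℕ} (ψ : E n → ℝ) : Prop where
  smooth : ContDiff ℝ ∞ ψ
  eq_zero : ∀ ξ : E n, ‖ξ‖ ≤ 1 / 2 → ψ ξ = 0
  eq_one : ∀ ξ : E n, 1 ≤ ‖ξ‖ → ψ ξ = 1

/-- `f` is smooth on `U × (ℝⁿ \ {0})` and positively homogeneous of degree `d` in `ξ`. -/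
structure IsHomogeneousSymbol {n : ℕ} (U : Set (E n)) (d : ℂ) (f : E n × E n → ℂ) : Prop where
  smooth : ContDiffOn ℝ ∞ f (U ×ˢ {ξ : E n | ξ ≠ 0})
  homogeneous : ∀ x ∈ U, ∀ ξ : E n, ξ ≠ 0 → ∀ t : ℝ, 0 < t →
    f (x, t • ξ) = (t : ℂ) ^ d * f (x, ξ)

/-- `h j` is the homogeneous component of degree `a - j` of the classical symbol `σ` of
order `a`: `σ ∼ ∑_j ψ h_j` for any cut-off function `ψ`. -/
structure HasClassicalExpansion {n : ℕ} (U : Set (E n)) (a : ℂ)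
    (σ : E n × E n → ℂ) (h : ℕ → E n × E n → ℂ) : Prop where
  component : ∀ j : ℕ, IsHomogeneousSymbol U (a - j) (h j)
  expansion : ∀ ψ : E n → ℝ, IsCutoff ψ →
    HasAsymptoticExpansion U (fun j => a - j) σ (fun j p => (ψ p.2 : ℂ) * h j p)

/-- `σ ∈ CS^a_odd(U)`, `a ∈ ℤ`: a classical symbol of order `a` whose homogeneous component of
degree `a - j` has the parity of `a - j` in `ξ`, for every `j`. -/
def IsOddClass {n : ℕ} (U : Set (E n)) (a : ℤ) (σ : E n × E n → ℂ) : Prop :=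
  IsSymbol U a σ ∧ ∃ h : ℕ → E n × E n → ℂ, HasClassicalExpansion U a σ h ∧
    ∀ j : ℕ, ∀ x ∈ U, ∀ ξ : E n, 1 ≤ ‖ξ‖ →
      h j (x, -ξ) = (-1 : ℂ) ^ (a - (j : ℤ)) * h j (x, ξ)

end

end OddClassSymbol

/-! The problem is solved on homogeneous components and then summed. It suffices that each component
`f` of degree `k` and parity `(-1)^k` is the divergence in `ξ` of a field of degree `k + 1` and
opposite parity (`exists_antidivergence`). Borel summation (`exists_hasClassicalExpansion`) turns
the resulting formal sums into symbols `τ i`, and matching components leave only a smoothing error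
(`isSmoothing_sub_divergence`).

If `n + k ≠ 0`, Euler's identity gives `div (ξ f) = (n + k) f`. The critical degree is `k = -n`. As
`n` is odd, `f` is then odd in `ξ`. The usual obstruction is the integral of `f` over the sphere,
which oddness kills; here an explicit field is built from rotations
(`exists_antidivergence_of_odd`). For a trace-free linear generator `J`, `div (G J ξ)` is the
derivative of `G` along the orbits of `J`. Integrating `f` over the circle group of `J` with weight
`θ / 2π` gives a `G` whose orbit derivative is `f - f₁`, where `f₁` is the average of `f`. A second
generator `J'` has half turn `-1` composed with a reflection which acts on each single vector like
some rotation of `J`. Since `f₁` is odd and invariant under `J`, it changes sign under this half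
turn, so integrating it over half an orbit of `J'` writes `f₁` as a derivative too.

The two generators need `n ≥ 3`. For `n = 1` the degree `-1` must be avoided: `1/ξ` has no primitive
that is homogeneous of degree `0`. -/

namespace OddClassSymbol

noncomputable section

/-! ### Iterated directional derivatives -/

/-- The iterated directional derivative along the word `vs` of directions. -/
def iterDir {n : ℕ} (vs : List (E n × E n)) (f : E n × E n → ℂ) : E n × E n → ℂ :=
  vs.foldr (fun v g p => fderiv ℝ g p v) f

/-- The word of directions of the derivative `∂_x^α ∂_ξ^β`. -/
def mixedDirs {n : ℕ} (α β : List (Fin n)) : List (E n × E n) :=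
  α.map (fun i => (EuclideanSpace.single i 1, 0)) ++
    β.map (fun i => (0, EuclideanSpace.single i 1))

/-- With both kinds of derivative in one word of directions, each calculus rule below takes a single
induction. -/
theorem iterX_iterXi {n : ℕ} (α β : List (Fin n)) (f : E n × E n → ℂ) :
    iterX α (iterXi β f) = iterDir (mixedDirs α β) f := by
  simp only [iterX, iterXi, iterDir, mixedDirs, List.foldr_append, List.foldr_map]
  rfl

variable {n : ℕ} {V : Set (E n × E n)} {f g : E n × E n → ℂ}

theorem iterDir_cons (v : E n × E n) (vs : List (E n × E n)) (f : E n × E n → ℂ) :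
    iterDir (v :: vs) f = fun p => fderiv ℝ (iterDir vs f) p v := rfl

theorem iterDir_eqOn (hV : IsOpen V) (h : Set.EqOn f g V) (vs : List (E n × E n)) :
    Set.EqOn (iterDir vs f) (iterDir vs g) V := by
  induction vs with
  | nil => exact h
  | cons v vs ih =>
    intro p hp
    simp only [iterDir_cons]
    rw [(ih.eventuallyEq_of_mem (hV.mem_nhds hp)).fderiv_eq]

theorem contDiffOn_fderiv_apply (hV : IsOpen V) (hf : ContDiffOn ℝ ∞ f V) (v : E n × E n) :
    ContDiffOn ℝ ∞ (fun p => fderiv ℝ f p v) V :=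
  ((contDiffOn_infty_iff_fderiv_of_isOpen hV).1 hf).2.clm_apply contDiffOn_const

theorem contDiffOn_iterDir (hV : IsOpen V) (hf : ContDiffOn ℝ ∞ f V) (vs : List (E n × E n)) :
    ContDiffOn ℝ ∞ (iterDir vs f) V := by
  induction vs with
  | nil => exact hf
  | cons v vs ih => exact contDiffOn_fderiv_apply hV ih v

theorem differentiableAt_of_contDiffOn (hV : IsOpen V) (hf : ContDiffOn ℝ ∞ f V)
    {p : E n × E n} (hp : p ∈ V) : DifferentiableAt ℝ f p :=
  (hf.contDiffAt (hV.mem_nhds hp)).differentiableAt (by simp)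

theorem iterDir_add (hV : IsOpen V) (hf : ContDiffOn ℝ ∞ f V) (hg : ContDiffOn ℝ ∞ g V)
    (vs : List (E n × E n)) :
    Set.EqOn (iterDir vs (fun p => f p + g p)) (fun p => iterDir vs f p + iterDir vs g p) V := by
  induction vs with
  | nil => exact fun p _ => rfl
  | cons v vs ih =>
    intro p hp
    simp only [iterDir_cons]
    rw [(ih.eventuallyEq_of_mem (hV.mem_nhds hp)).fderiv_eq,
      fderiv_fun_add (differentiableAt_of_contDiffOn hV (contDiffOn_iterDir hV hf vs) hp)
        (differentiableAt_of_contDiffOn hV (contDiffOn_iterDir hV hg vs) hp)]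
    rfl

theorem iterDir_const_mul (c : ℂ) (f : E n × E n → ℂ) (vs : List (E n × E n)) :
    iterDir vs (fun p => c * f p) = fun p => c * iterDir vs f p := by
  induction vs with
  | nil => rfl
  | cons v vs ih =>
    funext p
    rw [iterDir_cons, ih]
    have : (fun p => c * iterDir vs f p) = c • iterDir vs f := rfl
    rw [this, fderiv_const_smul_field]
    rfl

theorem iterDir_zero (vs : List (E n × E n)) :
    iterDir vs (fun _ => (0 : ℂ)) = fun _ => 0 := by
  simpa using iterDir_const_mul (n := n) 0 (fun _ => (0 : ℂ)) vs

theorem iterDir_sum (hV : IsOpen V) {ι : Type*} (s : Finset ι) {F : ι → E n × E n → ℂ}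
    (hF : ∀ i ∈ s, ContDiffOn ℝ ∞ (F i) V) (vs : List (E n × E n)) :
    Set.EqOn (iterDir vs (fun p => ∑ i ∈ s, F i p)) (fun p => ∑ i ∈ s, iterDir vs (F i) p) V := by
  classical
  induction s using Finset.induction_on with
  | empty => intro p _; simp [iterDir_zero]
  | insert i s hi ih =>
    intro p hp
    simp only [Finset.sum_insert hi]
    rw [iterDir_add hV (hF i (by simp))
      (ContDiffOn.sum fun j hj => hF j (by simp [hj])) vs hp]
    simp only
    rw [ih (fun j hj => hF j (by simp [hj])) hp]

/-- The scaling `(x, ξ) ↦ (x, t ξ)` of the cotangent variable. -/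
def scaleXi (t : ℝˣ) : (E n × E n) ≃L[ℝ] (E n × E n) :=
  (ContinuousLinearEquiv.refl ℝ (E n)).prodCongr (ContinuousLinearEquiv.smulLeft t)

@[simp] theorem scaleXi_apply (t : ℝˣ) (p : E n × E n) :
    scaleXi t p = (p.1, (t : ℝ) • p.2) := rfl

/-- Scaling fixes the `x`-directions and multiplies each `ξ`-direction by `t`. Composition with a
linear equivalence commutes with `fderiv` unconditionally, so `f` need not be smooth. -/
theorem iterDir_comp_scaleXi (t : ℝˣ) (f : E n × E n → ℂ) (α β : List (Fin n)) :
    iterDir (mixedDirs α β) (fun p => f (scaleXi t p)) =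
      fun p => ((t : ℝ) : ℂ) ^ β.length * iterDir (mixedDirs α β) f (scaleXi t p) := by
  have key : ∀ (g : E n × E n → ℂ) (v p : E n × E n),
      fderiv ℝ (fun p => g (scaleXi t p)) p v = fderiv ℝ g (scaleXi t p) (scaleXi t v) := by
    intro g v p
    have := (scaleXi (n := n) t).comp_right_fderiv (f := g) (x := p)
    exact congrArg (fun L => L v) this
  have mulkey : ∀ (c : ℂ) (g : E n × E n → ℂ) (p : E n × E n),
      fderiv ℝ (fun p => c * g p) p = c • fderiv ℝ g p := by
    intro c g p
    exact congrFun (fderiv_const_smul_field (f := g) c) p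
  induction α with
  | nil =>
    induction β with
    | nil => simp [mixedDirs, iterDir]
    | cons i β ih =>
      funext p
      change fderiv ℝ (iterDir (mixedDirs [] β) (fun p => f (scaleXi t p))) p _ =
        _ * fderiv ℝ (iterDir (mixedDirs [] β) f) (scaleXi t p) _
      have e : scaleXi t ((0 : E n), EuclideanSpace.single i (1 : ℝ)) =
          (t : ℝ) • ((0 : E n), EuclideanSpace.single i (1 : ℝ)) := by simp
      rw [ih, mulkey, smul_apply, key, e, map_smul, List.length_cons, pow_succ,
        smul_eq_mul, Complex.real_smul, mul_assoc]
  | cons i α ih =>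
    funext p
    change fderiv ℝ (iterDir (mixedDirs α β) (fun p => f (scaleXi t p))) p _ =
      _ * fderiv ℝ (iterDir (mixedDirs α β) f) (scaleXi t p) _
    have e : scaleXi t (EuclideanSpace.single i (1 : ℝ), (0 : E n)) =
        (EuclideanSpace.single i (1 : ℝ), (0 : E n)) := by simp
    rw [ih, mulkey, smul_apply, key, e, smul_eq_mul]

/-! ### Elementary properties of symbols -/

variable {U : Set (E n)} {a b : ℂ}

theorem isOpen_prod_univ (hU : IsOpen U) : IsOpen (U ×ˢ (Set.univ : Set (E n))) :=
  hU.prod isOpen_univ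

theorem IsSymbol.congr (hU : IsOpen U) (hf : IsSymbol U a f)
    (h : Set.EqOn g f (U ×ˢ Set.univ)) : IsSymbol U a g where
  smooth := hf.smooth.congr h
  bound K hK hKU α β := by
    obtain ⟨C, hC⟩ := hf.bound K hK hKU α β
    refine ⟨C, fun x hx ξ => ?_⟩
    rw [iterX_iterXi, iterDir_eqOn (isOpen_prod_univ hU) h _ ⟨hKU hx, Set.mem_univ _⟩,
      ← iterX_iterXi]
    exact hC x hx ξ

theorem IsSymbol.mono (hf : IsSymbol U a f) (hab : a.re ≤ b.re) : IsSymbol U b f where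
  smooth := hf.smooth
  bound K hK hKU α β := by
    obtain ⟨C, hC⟩ := hf.bound K hK hKU α β
    refine ⟨|C|, fun x hx ξ => (hC x hx ξ).trans ?_⟩
    have h1 : 1 ≤ 1 + ‖ξ‖ := by linarith [norm_nonneg ξ]
    gcongr
    exact le_abs_self C

theorem IsSymbol.add (hU : IsOpen U) (hf : IsSymbol U a f) (hg : IsSymbol U a g) :
    IsSymbol U a (fun p => f p + g p) where
  smooth := hf.smooth.add hg.smooth
  bound K hK hKU α β := by
    obtain ⟨C, hC⟩ := hf.bound K hK hKU α β
    obtain ⟨C', hC'⟩ := hg.bound K hK hKU α β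
    refine ⟨C + C', fun x hx ξ => ?_⟩
    have h1 := hC x hx ξ
    have h2 := hC' x hx ξ
    rw [iterX_iterXi] at h1 h2 ⊢
    rw [iterDir_add (isOpen_prod_univ hU) hf.smooth hg.smooth _ ⟨hKU hx, Set.mem_univ _⟩, add_mul]
    exact (norm_add_le _ _).trans (add_le_add h1 h2)

theorem IsSymbol.const_mul (c : ℂ) (hf : IsSymbol U a f) :
    IsSymbol U a (fun p => c * f p) where
  smooth := contDiffOn_const.mul hf.smooth
  bound K hK hKU α β := by
    obtain ⟨C, hC⟩ := hf.bound K hK hKU α β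
    refine ⟨‖c‖ * C, fun x hx ξ => ?_⟩
    have h1 := hC x hx ξ
    rw [iterX_iterXi] at h1 ⊢
    rw [iterDir_const_mul, norm_mul, mul_assoc]
    gcongr

theorem IsSymbol.sub (hU : IsOpen U) (hf : IsSymbol U a f) (hg : IsSymbol U a g) :
    IsSymbol U a (fun p => f p - g p) :=
  (hf.add hU (hg.const_mul (-1))).congr hU fun p _ => by ring

theorem IsSymbol.zero (U : Set (E n)) (a : ℂ) : IsSymbol U a (fun _ => 0) where
  smooth := contDiffOn_const
  bound K _ _ α β := ⟨0, fun x _ ξ => by simp [iterX_iterXi, iterDir_zero]⟩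

theorem IsSymbol.sum (hU : IsOpen U) {ι : Type*} (s : Finset ι) {F : ι → E n × E n → ℂ}
    (hF : ∀ i ∈ s, IsSymbol U a (F i)) : IsSymbol U a (fun p => ∑ i ∈ s, F i p) := by
  classical
  induction s using Finset.induction_on with
  | empty => simpa using IsSymbol.zero U a
  | insert i s hi ih =>
    simp only [Finset.sum_insert hi]
    exact (hF i (by simp)).add hU (ih fun j hj => hF j (by simp [hj]))

theorem IsSymbol.partialXi (hU : IsOpen U) (hf : IsSymbol U a f) (i : Fin n) :
    IsSymbol U (a - 1) (partialXi i f) where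
  smooth := contDiffOn_fderiv_apply (isOpen_prod_univ hU) hf.smooth _
  bound K hK hKU α β := by
    -- Appending `i` makes the new derivative the innermost one, so no partial derivatives have to
    -- be interchanged.
    obtain ⟨C, hC⟩ := hf.bound K hK hKU α (β ++ [i])
    refine ⟨C, fun x hx ξ => ?_⟩
    have h := hC x hx ξ
    have e : iterXi (β ++ [i]) f = iterXi β (OddClassSymbol.partialXi i f) := by simp [iterXi]
    rw [e] at h
    convert h using 3
    simp
    ring

/-- The symbol estimates have to be checked for large `ξ` only. -/
theorem isSymbol_of_bound_large (hU : IsOpen U) (hf : ContDiffOn ℝ ∞ f (U ×ˢ Set.univ)) (R : ℝ)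
    (hR : ∀ K : Set (E n), IsCompact K → K ⊆ U → ∀ α β : List (Fin n), ∃ C : ℝ, ∀ x ∈ K,
      ∀ ξ : E n, R < ‖ξ‖ →
        ‖iterDir (mixedDirs α β) f (x, ξ)‖ ≤ C * (1 + ‖ξ‖) ^ (a.re - (β.length : ℝ))) :
    IsSymbol U a f := by
  refine ⟨hf, fun K hK hKU α β => ?_⟩
  rw [iterX_iterXi]
  obtain ⟨C', hC'⟩ := hR K hK hKU α β
  set e : ℝ := a.re - (β.length : ℝ)
  -- For `‖ξ‖ ≤ R` the derivative divided by the weight is continuous on a compact set, hence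
  -- bounded.
  have hcont : ContinuousOn (fun p : E n × E n =>
      ‖iterDir (mixedDirs α β) f p‖ * (1 + ‖p.2‖) ^ (-e)) (K ×ˢ Metric.closedBall 0 R) := by
    refine ContinuousOn.mul ?_ (Continuous.continuousOn ?_)
    · exact ((contDiffOn_iterDir (isOpen_prod_univ hU) hf _).continuousOn.mono
        (Set.prod_mono hKU (Set.subset_univ _))).norm
    · exact Continuous.rpow_const (by fun_prop) fun p => Or.inl (by positivity)
  have hcomp : IsCompact (K ×ˢ Metric.closedBall (0 : E n) R) :=
    hK.prod (isCompact_closedBall 0 R)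
  obtain ⟨C, hC⟩ := hcomp.exists_bound_of_continuousOn hcont
  refine ⟨max C C', fun x hx ξ => ?_⟩
  by_cases hξ : R < ‖ξ‖
  · refine (hC' x hx ξ hξ).trans ?_
    gcongr
    exact le_max_right _ _
  · have hpos : 0 < 1 + ‖ξ‖ := by positivity
    have := (Real.le_norm_self _).trans (hC (x, ξ) (Set.mk_mem_prod hx (by simpa using hξ)))
    simp only [Real.rpow_neg hpos.le] at this
    rw [← div_eq_mul_inv, div_le_iff₀ (by positivity)] at this
    refine this.trans ?_
    gcongr
    exact le_max_left _ _

/-- A smooth function whose support is bounded in `ξ` is a smoothing symbol. -/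
theorem isSmoothing_of_eq_zero (hU : IsOpen U) (hf : ContDiffOn ℝ ∞ f (U ×ˢ Set.univ)) (R : ℝ)
    (hR : ∀ x ∈ U, ∀ ξ : E n, R < ‖ξ‖ → f (x, ξ) = 0) : IsSmoothing U f := by
  refine fun a => isSymbol_of_bound_large hU hf R fun K hK hKU α β => ⟨0, fun x hx ξ hξ => ?_⟩
  have hW : IsOpen (U ×ˢ {ξ : E n | R < ‖ξ‖}) :=
    hU.prod (isOpen_lt continuous_const continuous_norm)
  have hmem : (x, ξ) ∈ U ×ˢ {ξ : E n | R < ‖ξ‖} := Set.mk_mem_prod (hKU hx) hξ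
  rw [iterDir_eqOn (g := fun _ => 0) hW (fun p hp => hR p.1 hp.1 p.2 hp.2) _ hmem, iterDir_zero]
  simp

end

end OddClassSymbol

namespace OddClassSymbol

noncomputable section

/-! ### Homogeneous functions and their truncations -/

variable {n : ℕ} {U : Set (E n)} {h : E n × E n → ℂ} {k : ℤ} {ψ : E n → ℝ}

theorem isOpen_punctured (hU : IsOpen U) : IsOpen (U ×ˢ {ξ : E n | ξ ≠ 0}) :=
  hU.prod isOpen_ne

theorem mem_punctured {x ξ : E n} (hx : x ∈ U) (hξ : ξ ≠ 0) :
    (x, ξ) ∈ U ×ˢ {ξ : E n | ξ ≠ 0} :=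
  Set.mk_mem_prod hx hξ

/-- Allows comparable weights such as `‖ξ‖` and `1 + ‖ξ‖` to be exchanged whatever the sign of the
exponent. -/
theorem rpow_le_of_comparable {u v c : ℝ} (e : ℝ) (hu : 0 < u) (huv : u ≤ v) (hvc : v ≤ c * u) :
    u ^ e ≤ c ^ |e| * v ^ e ∧ v ^ e ≤ c ^ |e| * u ^ e := by
  have hv : 0 < v := hu.trans_le huv
  have hc : 1 ≤ c := by
    by_contra hc
    push Not at hc
    nlinarith
  have h1 : (1 : ℝ) ≤ c ^ |e| := Real.one_le_rpow hc (abs_nonneg e)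
  rcases le_or_gt 0 e with he | he
  · constructor
    · calc u ^ e ≤ v ^ e := Real.rpow_le_rpow hu.le huv he
        _ ≤ c ^ |e| * v ^ e := le_mul_of_one_le_left (by positivity) h1
    · rw [abs_of_nonneg he, ← Real.mul_rpow (by linarith) hu.le]
      exact Real.rpow_le_rpow hv.le hvc he
  · constructor
    · rw [abs_of_neg he, Real.rpow_neg (by linarith), ← Real.inv_rpow (by linarith),
        ← Real.mul_rpow (by positivity) hv.le]
      refine Real.rpow_le_rpow_of_nonpos (by positivity) ?_ he.le
      rw [inv_mul_le_iff₀ (by linarith)]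
      exact hvc
    · calc v ^ e ≤ u ^ e := Real.rpow_le_rpow_of_nonpos hu huv he.le
        _ ≤ c ^ |e| * u ^ e := le_mul_of_one_le_left (by positivity) h1

theorem IsHomogeneousSymbol.map_smul (hh : IsHomogeneousSymbol U (k : ℂ) h) {x ξ : E n}
    (hx : x ∈ U) (hξ : ξ ≠ 0) {t : ℝ} (ht : 0 < t) :
    h (x, t • ξ) = (t : ℂ) ^ k * h (x, ξ) := by
  rw [hh.homogeneous x hx ξ hξ t ht, Complex.cpow_intCast]

/-- Differentiating the homogeneity relation produces a factor `t ^ β.length` on the scaled side,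
which is divided out. -/
theorem IsHomogeneousSymbol.iterDir_smul (hU : IsOpen U) (hh : IsHomogeneousSymbol U (k : ℂ) h)
    (α β : List (Fin n)) {x ξ : E n} (hx : x ∈ U) (hξ : ξ ≠ 0) {t : ℝ} (ht : 0 < t) :
    iterDir (mixedDirs α β) h (x, t • ξ) =
      (t : ℂ) ^ (k - (β.length : ℤ)) * iterDir (mixedDirs α β) h (x, ξ) := by
  have htc : (t : ℂ) ≠ 0 := by exact_mod_cast ht.ne'
  have hmem : (x, ξ) ∈ U ×ˢ {ξ : E n | ξ ≠ 0} := Set.mk_mem_prod hx hξ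
  have heq : Set.EqOn (fun p => h (scaleXi (Units.mk0 t ht.ne') p)) (fun p => (t : ℂ) ^ k * h p)
      (U ×ˢ {ξ : E n | ξ ≠ 0}) := fun p hp => hh.map_smul hp.1 hp.2 ht
  have key := iterDir_eqOn (isOpen_punctured hU) heq (mixedDirs α β) hmem
  rw [iterDir_comp_scaleXi, iterDir_const_mul] at key
  simp only [scaleXi_apply, Units.val_mk0] at key
  rw [zpow_sub₀ htc, zpow_natCast, div_mul_eq_mul_div, ← key, mul_div_cancel_left₀ _
    (pow_ne_zero _ htc)]

/-- By homogeneity of the derivatives it is enough to bound them on the compact set `K × sphere`. -/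
theorem IsHomogeneousSymbol.exists_bound (hU : IsOpen U) (hh : IsHomogeneousSymbol U (k : ℂ) h)
    {K : Set (E n)} (hK : IsCompact K) (hKU : K ⊆ U) (α β : List (Fin n)) :
    ∃ C : ℝ, 0 ≤ C ∧ ∀ x ∈ K, ∀ ξ : E n, ξ ≠ 0 →
      ‖iterDir (mixedDirs α β) h (x, ξ)‖ ≤ C * ‖ξ‖ ^ ((k : ℝ) - (β.length : ℝ)) := by
  have hcomp : IsCompact (K ×ˢ Metric.sphere (0 : E n) 1) := hK.prod (isCompact_sphere 0 1)
  have hcont : ContinuousOn (iterDir (mixedDirs α β) h) (K ×ˢ Metric.sphere (0 : E n) 1) := by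
    refine (contDiffOn_iterDir (isOpen_punctured hU) hh.smooth _).continuousOn.mono
      (Set.prod_mono hKU fun ξ hξ => ?_)
    rintro rfl
    simp at hξ
  obtain ⟨C, hC⟩ := hcomp.exists_bound_of_continuousOn hcont
  refine ⟨max C 0, le_max_right _ _, fun x hx ξ hξ => ?_⟩
  have hpos : 0 < ‖ξ‖ := norm_pos_iff.2 hξ
  set η : E n := ‖ξ‖⁻¹ • ξ with hη
  have hηn : ‖η‖ = 1 := by rw [hη, norm_smul, norm_inv, norm_norm, inv_mul_cancel₀ hpos.ne']
  have hη0 : η ≠ 0 := by rw [← norm_pos_iff, hηn]; exact one_pos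
  have hξη : ξ = ‖ξ‖ • η := by rw [hη, smul_smul, mul_inv_cancel₀ hpos.ne', one_smul]
  have e1 : ‖iterDir (mixedDirs α β) h (x, ξ)‖ =
      ‖ξ‖ ^ (k - (β.length : ℤ)) * ‖iterDir (mixedDirs α β) h (x, η)‖ := by
    conv_lhs => rw [hξη, hh.iterDir_smul hU α β (hKU hx) hη0 hpos]
    simp
  have hCη := hC (x, η) (Set.mk_mem_prod hx (by simpa using hηn))
  have e2 : ‖ξ‖ ^ ((k : ℝ) - (β.length : ℝ)) = ‖ξ‖ ^ (k - (β.length : ℤ)) := by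
    rw [← Real.rpow_intCast]
    push_cast
    rfl
  rw [e1, e2, mul_comm]
  gcongr
  exact hCη.trans (le_max_left _ _)

/-- Near `ξ = 0` the product vanishes identically, so the singularity of `h` does not matter. -/
theorem contDiffOn_cutoff_mul (hU : IsOpen U) (hh : ContDiffOn ℝ ∞ h (U ×ˢ {ξ : E n | ξ ≠ 0}))
    (hψ : ContDiff ℝ ∞ ψ) {r : ℝ} (hr : 0 < r) (hr0 : ∀ ξ : E n, ‖ξ‖ < r → ψ ξ = 0) :
    ContDiffOn ℝ ∞ (fun p : E n × E n => (ψ p.2 : ℂ) * h p) (U ×ˢ Set.univ) := by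
  intro p hp
  refine ContDiffAt.contDiffWithinAt ?_
  by_cases h0 : p.2 = 0
  · have hev : (fun p : E n × E n => (ψ p.2 : ℂ) * h p) =ᶠ[nhds p] fun _ => 0 := by
      have : IsOpen {q : E n × E n | ‖q.2‖ < r} := isOpen_lt (by fun_prop) continuous_const
      filter_upwards [this.mem_nhds (show ‖p.2‖ < r by simpa [h0] using hr)] with q hq
      simp [hr0 q.2 hq]
    exact contDiffAt_const.congr_of_eventuallyEq hev
  · have hmem : p ∈ U ×ˢ {ξ : E n | ξ ≠ 0} := Set.mk_mem_prod hp.1 h0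
    refine ContDiffAt.mul ?_ (hh.contDiffAt ((isOpen_punctured hU).mem_nhds hmem))
    exact (Complex.ofRealCLM.contDiff.comp (hψ.comp contDiff_snd)).contDiffAt

theorem IsCutoff.contDiffOn_mul (hψ : IsCutoff ψ) (hU : IsOpen U)
    (hh : ContDiffOn ℝ ∞ h (U ×ˢ {ξ : E n | ξ ≠ 0})) :
    ContDiffOn ℝ ∞ (fun p : E n × E n => (ψ p.2 : ℂ) * h p) (U ×ˢ Set.univ) :=
  contDiffOn_cutoff_mul hU hh hψ.smooth one_half_pos fun ξ hξ => hψ.eq_zero ξ hξ.le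

/-- The truncation of a homogeneous function is a symbol. -/
theorem IsHomogeneousSymbol.isSymbol_cutoff_mul (hU : IsOpen U)
    (hh : IsHomogeneousSymbol U (k : ℂ) h) (hψ : IsCutoff ψ) :
    IsSymbol U (k : ℂ) (fun p : E n × E n => (ψ p.2 : ℂ) * h p) := by
  refine isSymbol_of_bound_large hU (hψ.contDiffOn_mul hU hh.smooth) 1 fun K hK hKU α β => ?_
  obtain ⟨C, hC0, hC⟩ := hh.exists_bound hU hK hKU α β
  refine ⟨C * 2 ^ |(k : ℝ) - (β.length : ℝ)|, fun x hx ξ hξ => ?_⟩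
  have hW : IsOpen (U ×ˢ {ξ : E n | 1 < ‖ξ‖}) :=
    hU.prod (isOpen_lt continuous_const continuous_norm)
  have hmem : (x, ξ) ∈ U ×ˢ {ξ : E n | 1 < ‖ξ‖} := Set.mk_mem_prod (hKU hx) hξ
  have heq : Set.EqOn (fun p : E n × E n => (ψ p.2 : ℂ) * h p) h (U ×ˢ {ξ : E n | 1 < ‖ξ‖}) := by
    intro p hp
    simp [hψ.eq_one p.2 (le_of_lt hp.2)]
  rw [iterDir_eqOn hW heq _ hmem]
  have hpos : 0 < ‖ξ‖ := one_pos.trans hξ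
  refine (hC x hx ξ (norm_pos_iff.1 hpos)).trans ?_
  rw [mul_assoc, Complex.intCast_re]
  gcongr
  exact (rpow_le_of_comparable _ hpos (by linarith) (by linarith)).1

/-- Truncation at radius `R` is the dilation of truncation at radius `1`, up to `R ^ k`. One set of
symbol constants therefore serves all `R`. -/
theorem IsCutoff.scaled_mul_eqOn (hψ : IsCutoff ψ) (hh : IsHomogeneousSymbol U (k : ℂ) h) {R : ℝ}
    (hR : 0 < R) :
    Set.EqOn (fun p : E n × E n => (ψ (R⁻¹ • p.2) : ℂ) * h p)
      (fun p => (R : ℂ) ^ k *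
        (fun p : E n × E n => (ψ p.2 : ℂ) * h p) (scaleXi (Units.mk0 R⁻¹ (inv_ne_zero hR.ne')) p))
      (U ×ˢ Set.univ) := by
  intro p hp
  have hRc : (R : ℂ) ≠ 0 := by exact_mod_cast hR.ne'
  simp only [scaleXi_apply, Units.val_mk0]
  by_cases h0 : p.2 = 0
  · simp [h0, hψ.eq_zero 0 (by simp)]
  · rw [hh.map_smul hp.1 h0 (inv_pos.2 hR)]
    push_cast
    rw [inv_zpow, Prod.mk.eta]
    field_simp

/-- The truncations of a homogeneous function outside balls of radius `R ≥ 1` satisfy symbol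
estimates uniformly in `R`. -/
theorem IsHomogeneousSymbol.exists_bound_scaled_cutoff_mul (hU : IsOpen U)
    (hh : IsHomogeneousSymbol U (k : ℂ) h) (hψ : IsCutoff ψ)
    {K : Set (E n)} (hK : IsCompact K) (hKU : K ⊆ U) (α β : List (Fin n)) :
    ∃ C : ℝ, 0 ≤ C ∧ ∀ R : ℝ, 1 ≤ R → ∀ x ∈ K, ∀ ξ : E n,
      ‖iterDir (mixedDirs α β) (fun p : E n × E n => (ψ (R⁻¹ • p.2) : ℂ) * h p) (x, ξ)‖ ≤
        C * (1 + ‖ξ‖) ^ ((k : ℝ) - (β.length : ℝ)) ∧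
      (‖ξ‖ < R / 2 →
        iterDir (mixedDirs α β) (fun p : E n × E n => (ψ (R⁻¹ • p.2) : ℂ) * h p) (x, ξ) = 0) := by
  obtain ⟨C, hC⟩ := (hh.isSymbol_cutoff_mul hU hψ).bound K hK hKU α β
  set e : ℝ := (k : ℝ) - (β.length : ℝ) with he
  rw [iterX_iterXi, Complex.intCast_re, ← he] at hC
  -- The `3` comes from `1 + ‖ξ‖ ≤ R + ‖ξ‖ ≤ 3 (1 + ‖ξ‖)`, valid where `‖ξ‖ ≥ R / 2`; elsewhere the
  -- derivative is zero.
  refine ⟨|C| * 3 ^ |e|, by positivity, fun R hR x hx ξ => ?_⟩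
  have hR0 : 0 < R := by linarith
  have hzero : ‖ξ‖ < R / 2 →
      iterDir (mixedDirs α β) (fun p : E n × E n => (ψ (R⁻¹ • p.2) : ℂ) * h p) (x, ξ) = 0 := by
    intro hξ
    have hW : IsOpen (U ×ˢ {ξ : E n | ‖ξ‖ < R / 2}) :=
      hU.prod (isOpen_lt continuous_norm continuous_const)
    have hmem : (x, ξ) ∈ U ×ˢ {ξ : E n | ‖ξ‖ < R / 2} := Set.mk_mem_prod (hKU hx) hξ
    have heq : Set.EqOn (fun p : E n × E n => (ψ (R⁻¹ • p.2) : ℂ) * h p) (fun _ => 0)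
        (U ×ˢ {ξ : E n | ‖ξ‖ < R / 2}) := by
      intro p hp
      have hp2 : ‖p.2‖ < R / 2 := hp.2
      have : ‖R⁻¹ • p.2‖ ≤ 1 / 2 := by
        rw [norm_smul, norm_inv, Real.norm_of_nonneg hR0.le, inv_mul_le_iff₀ hR0]
        linarith
      simp [hψ.eq_zero _ this]
    rw [iterDir_eqOn hW heq _ hmem, iterDir_zero]
  refine ⟨?_, hzero⟩
  rcases lt_or_ge ‖ξ‖ (R / 2) with hξ | hξ
  · rw [hzero hξ, norm_zero]
    positivity
  · rw [iterDir_eqOn (isOpen_prod_univ hU) (hψ.scaled_mul_eqOn hh hR0) _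
      (Set.mk_mem_prod (hKU hx) (Set.mem_univ _)), iterDir_const_mul]
    beta_reduce
    rw [iterDir_comp_scaleXi _ (fun p : E n × E n => (ψ p.2 : ℂ) * h p)]
    simp only [scaleXi_apply, Units.val_mk0, norm_mul, norm_pow, norm_zpow, Complex.norm_real,
      norm_inv, Real.norm_of_nonneg hR0.le]
    have e1 : R ^ k * R⁻¹ ^ β.length = R ^ e := by
      rw [he, Real.rpow_sub hR0, Real.rpow_intCast, Real.rpow_natCast, inv_pow, div_eq_mul_inv]
    have e2 : R ^ e * (1 + ‖R⁻¹ • ξ‖) ^ e = (R + ‖ξ‖) ^ e := by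
      rw [← Real.mul_rpow hR0.le (by positivity), norm_smul, norm_inv, Real.norm_of_nonneg hR0.le]
      congr 1
      field_simp
    rw [← mul_assoc, e1]
    calc _ ≤ R ^ e * (|C| * (1 + ‖R⁻¹ • ξ‖) ^ e) := by
          gcongr
          refine (hC x hx (R⁻¹ • ξ)).trans ?_
          gcongr
          exact le_abs_self C
      _ = |C| * (R + ‖ξ‖) ^ e := by rw [← e2]; ring
      _ ≤ |C| * 3 ^ |e| * (1 + ‖ξ‖) ^ e := by
          rw [mul_assoc]
          gcongr
          exact (rpow_le_of_comparable e (by positivity) (by linarith) (by linarith)).2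

end

end OddClassSymbol

namespace OddClassSymbol

noncomputable section

/-! ### Asymptotic summation of homogeneous functions -/

theorem exists_isCutoff (n : ℕ) : ∃ ψ : E n → ℝ, IsCutoff ψ := by
  let b : ContDiffBump (0 : E n) := ⟨1 / 2, 1, by norm_num, by norm_num⟩
  refine ⟨fun ξ => 1 - b ξ, contDiff_const.sub b.contDiff, fun ξ hξ => ?_, fun ξ hξ => ?_⟩
  · rw [b.one_of_mem_closedBall (mem_closedBall_zero_iff.2 hξ), sub_self]
  · rw [b.zero_of_le_dist (by simpa using hξ), sub_zero]

/-- An open subset of `ℝⁿ` is exhausted by a sequence of compact sets. -/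
theorem exists_compact_exhaustion {n : ℕ} {U : Set (E n)} (hU : IsOpen U) :
    ∃ K : ℕ → Set (E n), (∀ j, IsCompact (K j)) ∧ (∀ j, K j ⊆ U) ∧
      ∀ L : Set (E n), IsCompact L → L ⊆ U → ∃ j₀, ∀ j, j₀ ≤ j → L ⊆ K j := by
  have : LocallyCompactSpace U := hU.locallyCompactSpace
  let ex : CompactExhaustion U := CompactExhaustion.choice U
  refine ⟨fun j => Subtype.val '' ex j, fun j => (ex.isCompact j).image continuous_subtype_val,
    fun j => ?_, fun L hL hLU => ?_⟩
  · rintro _ ⟨x, -, rfl⟩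
    exact x.2
  · have hL' : IsCompact ((Subtype.val : U → E n) ⁻¹' L) := by
      rw [Topology.IsEmbedding.subtypeVal.isCompact_iff, Set.image_preimage_eq_inter_range,
        Subtype.range_coe, Set.inter_eq_left.2 hLU]
      exact hL
    obtain ⟨j₀, hj₀⟩ := ex.exists_superset_of_isCompact hL'
    refine ⟨j₀, fun j hj x hx => ⟨⟨x, hLU hx⟩, ex.subset hj (hj₀ hx), rfl⟩⟩

variable {n : ℕ} {U : Set (E n)} {ψ : E n → ℝ}

/-- Truncating far enough from the origin makes finitely many symbol constants small, at the
expense of one order. -/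
theorem IsHomogeneousSymbol.exists_radius {h : E n × E n → ℂ} {k : ℤ} (hU : IsOpen U)
    (hh : IsHomogeneousSymbol U (k : ℂ) h) (hψ : IsCutoff ψ) {K : Set (E n)} (hK : IsCompact K)
    (hKU : K ⊆ U) (N : ℕ) {ε : ℝ} (hε : 0 < ε) (ρ : ℝ) :
    ∃ R : ℝ, 1 ≤ R ∧ ρ ≤ R ∧ ∀ α β : List (Fin n), α.length ≤ N → β.length ≤ N →
      ∀ x ∈ K, ∀ ξ : E n,
        ‖iterDir (mixedDirs α β) (fun p : E n × E n => (ψ (R⁻¹ • p.2) : ℂ) * h p) (x, ξ)‖ ≤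
          ε * (1 + ‖ξ‖) ^ ((k : ℝ) + 1 - (β.length : ℝ)) := by
  choose C hC0 hC using hh.exists_bound_scaled_cutoff_mul hU hψ hK hKU
  let S : Finset (List (Fin n)) := (List.finite_length_le (Fin n) N).toFinset
  let B : ℝ := ∑ α ∈ S, ∑ β ∈ S, C α β
  -- The derivatives vanish unless `‖ξ‖ ≥ R / 2 ≥ B / ε`, and there `B ≤ ε (1 + ‖ξ‖)`: the extra
  -- order pays for the small constant.
  refine ⟨max 1 (max ρ (2 * B / ε)), le_max_left _ _,
    (le_max_left _ _).trans (le_max_right _ _), fun α β hα hβ x hx ξ => ?_⟩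
  set R : ℝ := max 1 (max ρ (2 * B / ε))
  have hR1 : 1 ≤ R := le_max_left _ _
  have hRB : 2 * B / ε ≤ R := (le_max_right _ _).trans (le_max_right _ _)
  have hαS : α ∈ S := by simpa [S] using hα
  have hβS : β ∈ S := by simpa [S] using hβ
  have hCB : C α β ≤ B :=
    (Finset.single_le_sum (f := fun β => C α β) (fun β _ => hC0 α β) hβS).trans
      (Finset.single_le_sum (f := fun α => ∑ β ∈ S, C α β)
        (fun α _ => Finset.sum_nonneg fun β _ => hC0 α β) hαS)
  obtain ⟨h1, h2⟩ := hC α β R hR1 x hx ξ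
  rcases lt_or_ge ‖ξ‖ (R / 2) with hξ | hξ
  · rw [h2 hξ, norm_zero]
    positivity
  · refine h1.trans ?_
    have hpos : 0 < 1 + ‖ξ‖ := by positivity
    have e1 : (1 + ‖ξ‖) ^ ((k : ℝ) + 1 - (β.length : ℝ)) =
        (1 + ‖ξ‖) * (1 + ‖ξ‖) ^ ((k : ℝ) - (β.length : ℝ)) := by
      rw [add_sub_right_comm, Real.rpow_add_one hpos.ne', mul_comm]
    rw [e1, ← mul_assoc]
    gcongr
    rw [div_le_iff₀ hε] at hRB
    nlinarith

theorem IsCutoff.scaled_eq_zero (hψ : IsCutoff ψ) {R : ℝ} (hR : 0 < R) {ξ : E n}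
    (hξ : ‖ξ‖ ≤ R / 2) : ψ (R⁻¹ • ξ) = 0 := by
  refine hψ.eq_zero _ ?_
  rw [norm_smul, norm_inv, Real.norm_of_nonneg hR.le, inv_mul_le_iff₀ hR]
  linarith

theorem IsCutoff.scaled_eq_one (hψ : IsCutoff ψ) {R : ℝ} (hR : 0 < R) {ξ : E n}
    (hξ : R ≤ ‖ξ‖) : ψ (R⁻¹ • ξ) = 1 := by
  refine hψ.eq_one _ ?_
  rw [norm_smul, norm_inv, Real.norm_of_nonneg hR.le, le_inv_mul_iff₀ hR]
  linarith

theorem IsCutoff.contDiffOn_scaled_mul (hψ : IsCutoff ψ) (hU : IsOpen U) {h : E n × E n → ℂ}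
    (hh : ContDiffOn ℝ ∞ h (U ×ˢ {ξ : E n | ξ ≠ 0})) {R : ℝ} (hR : 0 < R) :
    ContDiffOn ℝ ∞ (fun p : E n × E n => (ψ (R⁻¹ • p.2) : ℂ) * h p) (U ×ˢ Set.univ) :=
  contDiffOn_cutoff_mul (ψ := fun ξ => ψ (R⁻¹ • ξ)) hU hh
    (hψ.smooth.comp (contDiff_const_smul _)) (half_pos hR) fun _ hξ => hψ.scaled_eq_zero hR hξ.le

/-- If the truncation radii grow fast enough, the tails of the series of truncated homogeneous
functions are symbols. -/
theorem isSymbol_tsum_sub_sum (hU : IsOpen U) (hψ : IsCutoff ψ) {m : ℤ} {h : ℕ → E n × E n → ℂ}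
    (hh : ∀ j : ℕ, IsHomogeneousSymbol U ((m - j : ℤ) : ℂ) (h j)) {K : ℕ → Set (E n)}
    (hKex : ∀ L : Set (E n), IsCompact L → L ⊆ U → ∃ j₀, ∀ j, j₀ ≤ j → L ⊆ K j)
    {R : ℕ → ℝ} (hR1 : ∀ j, 1 ≤ R j) (hRj : ∀ j : ℕ, 2 * (j : ℝ) ≤ R j)
    (hR : ∀ j, ∀ α β : List (Fin n), α.length ≤ j → β.length ≤ j → ∀ x ∈ K j, ∀ ξ : E n,
      ‖iterDir (mixedDirs α β) (fun p : E n × E n => (ψ ((R j)⁻¹ • p.2) : ℂ) * h j p) (x, ξ)‖ ≤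
        (1 / 2) ^ j * (1 + ‖ξ‖) ^ (((m - j : ℤ) : ℝ) + 1 - (β.length : ℝ))) (N : ℕ) :
    IsSymbol U ((m - N : ℤ) : ℂ) (fun p : E n × E n =>
      (∑' j, (ψ ((R j)⁻¹ • p.2) : ℂ) * h j p) -
        ∑ j ∈ Finset.range N, (ψ ((R j)⁻¹ • p.2) : ℂ) * h j p) := by
  have hR0 : ∀ j, 0 < R j := fun j => one_pos.trans_le (hR1 j)
  set s : ℕ → E n × E n → ℂ := fun j p => (ψ ((R j)⁻¹ • p.2) : ℂ) * h j p with hs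
  have hssm : ∀ j, ContDiffOn ℝ ∞ (s j) (U ×ˢ Set.univ) := fun j =>
    hψ.contDiffOn_scaled_mul hU (hh j).smooth (hR0 j)
  let W : ℕ → Set (E n × E n) := fun M => U ×ˢ {ξ : E n | ‖ξ‖ < M}
  have hW : ∀ M, IsOpen (W M) := fun M =>
    hU.prod (isOpen_lt continuous_norm continuous_const)
  have hWU : ∀ M, W M ⊆ U ×ˢ Set.univ := fun M => Set.prod_mono subset_rfl (Set.subset_univ _)
  -- The series is locally finite: if `‖ξ‖ < M ≤ j`, then `‖ξ‖ < R j / 2` and the `j`-th term is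
  -- zero.
  have hfin : ∀ M, N ≤ M → Set.EqOn (fun p => (∑' j, s j p) - ∑ j ∈ Finset.range N, s j p)
      (fun p => ∑ j ∈ Finset.Ico N M, s j p) (W M) := by
    intro M hM p hp
    have hp2 : ‖p.2‖ < M := hp.2
    simp only
    rw [tsum_eq_sum (s := Finset.range M) fun j hj => ?_, Finset.sum_Ico_eq_sub _ hM]
    rw [Finset.mem_range, not_lt] at hj
    have hjM : (M : ℝ) ≤ j := by exact_mod_cast hj
    simp [hs, hψ.scaled_eq_zero (hR0 j) (ξ := p.2) (by linarith [hRj j])]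
  refine ⟨fun p hp => ContDiffAt.contDiffWithinAt ?_, fun L hL hLU α β => ?_⟩
  · obtain ⟨M, hM⟩ := exists_nat_gt (max (N : ℝ) ‖p.2‖)
    have hNM : N ≤ M := by exact_mod_cast ((le_max_left _ _).trans_lt hM).le
    have hmem : p ∈ W M := Set.mk_mem_prod hp.1 ((le_max_right _ _).trans_lt hM)
    refine ContDiffAt.congr_of_eventuallyEq ?_
      ((hfin M hNM).eventuallyEq_of_mem ((hW M).mem_nhds hmem))
    exact ContDiffAt.sum fun j _ =>
      (hssm j).contDiffAt ((isOpen_prod_univ hU).mem_nhds (hWU M hmem))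
  · rw [iterX_iterXi, Complex.intCast_re]
    obtain ⟨j₀, hj₀⟩ := hKex L hL hLU
    choose C hC0 hC using fun j => (hh j).exists_bound_scaled_cutoff_mul hU hψ hL hLU α β
    -- From `J` on, `L ⊆ K j`, both words are short enough for `hR`, and `j ≥ N + 1` makes up for
    -- the order lost there. The finitely many earlier terms keep their own constants `C j`.
    let J : ℕ := max (max j₀ (N + 1)) (max α.length β.length)
    let c : ℕ → ℝ := fun j => (if j < J then C j else 0) + (1 / 2) ^ j
    have hc0 : ∀ j, 0 ≤ c j := fun j => by
      have := hC0 j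
      dsimp only [c]
      split_ifs <;> positivity
    have hcsum : Summable c := by
      refine Summable.add ?_ (summable_geometric_of_lt_one (by norm_num) (by norm_num))
      refine summable_of_ne_finset_zero (s := Finset.range J) fun j hj => ?_
      rw [Finset.mem_range] at hj
      simp [hj]
    refine ⟨∑' j, c j, fun x hx ξ => ?_⟩
    have h1 : 1 ≤ 1 + ‖ξ‖ := by linarith [norm_nonneg ξ]
    have hterm : ∀ j, N ≤ j → ‖iterDir (mixedDirs α β) (s j) (x, ξ)‖ ≤
        c j * (1 + ‖ξ‖) ^ (((m - N : ℤ) : ℝ) - (β.length : ℝ)) := by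
      intro j hj
      have hjN : (N : ℝ) ≤ j := by exact_mod_cast hj
      by_cases hjJ : j < J
      · refine (hC j (R j) (hR1 j) x hx ξ).1.trans ?_
        have : C j ≤ c j := by simp [c, hjJ]
        have := hc0 j
        gcongr
      · push Not at hjJ
        have hJ1 : j₀ ≤ J := (le_max_left _ _).trans (le_max_left _ _)
        have hJ2 : N + 1 ≤ J := (le_max_right _ _).trans (le_max_left _ _)
        have hJ3 : α.length ≤ J := (le_max_left _ _).trans (le_max_right _ _)
        have hJ4 : β.length ≤ J := (le_max_right _ _).trans (le_max_right _ _)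
        refine (hR j α β (hJ3.trans hjJ) (hJ4.trans hjJ) x (hj₀ j (hJ1.trans hjJ) hx) ξ).trans ?_
        have hNj : (N : ℝ) + 1 ≤ j := by exact_mod_cast hJ2.trans hjJ
        have : (1 / 2 : ℝ) ^ j ≤ c j := by simp [c, not_lt.2 hjJ]
        have := hc0 j
        gcongr
        push_cast
        linarith
    -- `M` depends on `ξ`, so the finite sums are finally bounded by the full sum of `c`, which does
    -- not.
    obtain ⟨M, hM⟩ := exists_nat_gt (max (N : ℝ) ‖ξ‖)
    have hNM : N ≤ M := by exact_mod_cast ((le_max_left _ _).trans_lt hM).le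
    have hmem : (x, ξ) ∈ W M := Set.mk_mem_prod (hLU hx) ((le_max_right _ _).trans_lt hM)
    rw [iterDir_eqOn (hW M) (hfin M hNM) _ hmem,
      iterDir_sum (hW M) _ (fun j _ => (hssm j).mono (hWU M)) _ hmem]
    calc ‖∑ j ∈ Finset.Ico N M, iterDir (mixedDirs α β) (s j) (x, ξ)‖
        ≤ ∑ j ∈ Finset.Ico N M, c j * (1 + ‖ξ‖) ^ (((m - N : ℤ) : ℝ) - (β.length : ℝ)) :=
          norm_sum_le_of_le _ fun j hj => hterm j (Finset.mem_Ico.1 hj).1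
      _ = (∑ j ∈ Finset.Ico N M, c j) * (1 + ‖ξ‖) ^ (((m - N : ℤ) : ℝ) - (β.length : ℝ)) := by
          rw [Finset.sum_mul]
      _ ≤ _ := by
          gcongr
          exact hcsum.sum_le_tsum _ fun j _ => hc0 j

/-- Every formal sum of homogeneous functions is the expansion of a classical symbol. -/
theorem exists_hasClassicalExpansion (hU : IsOpen U) (m : ℤ) {h : ℕ → E n × E n → ℂ}
    (hh : ∀ j : ℕ, IsHomogeneousSymbol U ((m - j : ℤ) : ℂ) (h j)) :
    ∃ τ : E n × E n → ℂ, HasClassicalExpansion U m τ h := by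
  obtain ⟨ψ, hψ⟩ := exists_isCutoff n
  obtain ⟨K, hK, hKU, hKex⟩ := exists_compact_exhaustion hU
  choose R hR1 hRj hR using fun j : ℕ => (hh j).exists_radius hU hψ (hK j) (hKU j) j
    (ε := (1 / 2) ^ j) (by positivity) (2 * (j : ℝ))
  have hR0 : ∀ j, 0 < R j := fun j => one_pos.trans_le (hR1 j)
  have hcast : ∀ j : ℕ, ((m - j : ℤ) : ℂ) = (m : ℂ) - j := fun j => by push_cast; rfl
  refine ⟨fun p => ∑' j, (ψ ((R j)⁻¹ • p.2) : ℂ) * h j p, fun j => hcast j ▸ hh j,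
    fun χ hχ => ⟨?_, fun j => hcast j ▸ (hh j).isSymbol_cutoff_mul hU hχ, fun N => ?_⟩⟩
  · simp only [Complex.sub_re, Complex.intCast_re, Complex.natCast_re]
    exact Filter.tendsto_atBot_add_const_left _ _
      (Filter.tendsto_neg_atTop_atBot.comp tendsto_natCast_atTop_atTop)
  · rw [← hcast]
    have h1 := isSymbol_tsum_sub_sum hU hψ hh hKex hR1 hRj hR N
    -- Replacing the rescaled cut-offs by `χ` changes each term only for bounded `ξ`, a smoothing
    -- error.
    have h2 : IsSymbol U ((m - N : ℤ) : ℂ) (fun p : E n × E n => ∑ j ∈ Finset.range N,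
        ((ψ ((R j)⁻¹ • p.2) : ℂ) * h j p - (χ p.2 : ℂ) * h j p)) := by
      refine IsSymbol.sum hU _ fun j _ => isSmoothing_of_eq_zero hU
        ((hψ.contDiffOn_scaled_mul hU (hh j).smooth (hR0 j)).sub
          (hχ.contDiffOn_mul hU (hh j).smooth)) (R j) (fun x _ ξ hξ => ?_) _
      simp only
      rw [hψ.scaled_eq_one (hR0 j) hξ.le, hχ.eq_one ξ ((hR1 j).trans hξ.le), sub_self]
    refine (h1.add hU h2).congr hU fun p _ => ?_
    simp only [Finset.sum_sub_distrib]
    ring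

end

end OddClassSymbol

/-! ### Smooth dependence of interval integrals on parameters -/

section ParametricIntegral

open MeasureTheory

universe u

theorem continuous_slice {P F : Type*} [TopologicalSpace P] [TopologicalSpace F]
    {V : Set P} {H : P × ℝ → F} (hH : ContinuousOn H (V ×ˢ Set.univ))
    {p : P} (hp : p ∈ V) : Continuous fun t => H (p, t) := by
  rw [← continuousOn_univ]
  exact hH.comp (by fun_prop) fun t _ => Set.mk_mem_prod hp (Set.mem_univ t)

variable {P F : Type u} [NormedAddCommGroup P] [NormedSpace ℝ P]
  [NormedAddCommGroup F] [NormedSpace ℝ F]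

theorem hasFDerivAt_slice {V : Set P} (hV : IsOpen V) {H : P × ℝ → F}
    (hH : ContDiffOn ℝ ∞ H (V ×ˢ Set.univ)) {p : P} (hp : p ∈ V) (t : ℝ) :
    HasFDerivAt (fun q => H (q, t))
      ((fderiv ℝ H (p, t)).comp (ContinuousLinearMap.inl ℝ P ℝ)) p := by
  have h1 : HasFDerivAt H (fderiv ℝ H (p, t)) (p, t) :=
    ((hH.contDiffAt ((hV.prod isOpen_univ).mem_nhds (Set.mk_mem_prod hp (Set.mem_univ t))))
      |>.differentiableAt (by simp)).hasFDerivAt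
  have h2 : HasFDerivAt (fun q : P => (q, t)) (ContinuousLinearMap.inl ℝ P ℝ) p :=
    hasFDerivAt_prodMk_left p t
  exact h1.comp p h2

theorem contDiffOn_fderiv_comp_inl {V : Set P} (hV : IsOpen V) {H : P × ℝ → F}
    (hH : ContDiffOn ℝ ∞ H (V ×ˢ Set.univ)) :
    ContDiffOn ℝ ∞ (fun q : P × ℝ => (fderiv ℝ H q).comp (ContinuousLinearMap.inl ℝ P ℝ))
      (V ×ˢ Set.univ) :=
  ((contDiffOn_infty_iff_fderiv_of_isOpen (hV.prod isOpen_univ)).1 hH).2.clm_comp contDiffOn_const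

/-- Differentiation under an integral over a compact interval. -/
theorem hasFDerivAt_intervalIntegral_of_contDiffOn [ProperSpace P] {V : Set P} (hV : IsOpen V)
    {H : P × ℝ → F} (hH : ContDiffOn ℝ ∞ H (V ×ˢ Set.univ)) (a b : ℝ) {p : P} (hp : p ∈ V) :
    HasFDerivAt (fun q => ∫ t in a..b, H (q, t))
      (∫ t in a..b, (fderiv ℝ H (p, t)).comp (ContinuousLinearMap.inl ℝ P ℝ)) p := by
  have hD := (contDiffOn_fderiv_comp_inl hV hH).continuousOn
  -- A compact ball around `p` times the interval supplies a constant dominating function.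
  obtain ⟨r, hr, hrV⟩ := Metric.nhds_basis_closedBall.mem_iff.1 (hV.mem_nhds hp)
  have hcomp : IsCompact (Metric.closedBall p r ×ˢ Set.uIcc a b) :=
    (isCompact_closedBall p r).prod isCompact_uIcc
  obtain ⟨C, hC⟩ := hcomp.exists_bound_of_continuousOn
    (hD.mono (Set.prod_mono hrV (Set.subset_univ _)))
  refine intervalIntegral.hasFDerivAt_integral_of_dominated_of_fderiv_le
    (F := fun q t => H (q, t))
    (F' := fun q t => (fderiv ℝ H (q, t)).comp (ContinuousLinearMap.inl ℝ P ℝ))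
    (bound := fun _ => C) (Metric.closedBall_mem_nhds p hr) ?_ ?_ ?_ ?_ ?_ ?_
  · filter_upwards [hV.mem_nhds hp] with q hq
    exact (continuous_slice hH.continuousOn hq).aestronglyMeasurable
  · exact (continuous_slice hH.continuousOn hp).intervalIntegrable _ _
  · exact (continuous_slice hD hp).aestronglyMeasurable
  · exact Filter.Eventually.of_forall fun t ht q hq =>
      hC (q, t) (Set.mk_mem_prod hq (Set.uIoc_subset_uIcc ht))
  · exact intervalIntegrable_const
  · exact Filter.Eventually.of_forall fun t _ q hq => hasFDerivAt_slice hV hH (hrV hq) t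

/-- An integral over a compact interval depends smoothly on parameters. -/
theorem contDiffOn_intervalIntegral [ProperSpace P] {V : Set P} (hV : IsOpen V) {H : P × ℝ → F}
    (hH : ContDiffOn ℝ ∞ H (V ×ˢ Set.univ)) (a b : ℝ) :
    ContDiffOn ℝ ∞ (fun q => ∫ t in a..b, H (q, t)) V := by
  rw [contDiffOn_infty]
  intro m
  -- The derivative is an integral of the same kind with values in `P →L[ℝ] F`. Hence the codomain
  -- varies, and `P` and `F` share a universe.
  induction m generalizing F with
  | zero =>
    rw [Nat.cast_zero, contDiffOn_zero]
    exact fun q hq =>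
      (hasFDerivAt_intervalIntegral_of_contDiffOn hV hH a b hq).continuousAt.continuousWithinAt
  | succ m ih =>
    rw [Nat.cast_succ, contDiffOn_succ_iff_fderiv_of_isOpen hV]
    refine ⟨fun q hq => (hasFDerivAt_intervalIntegral_of_contDiffOn hV hH a b hq)
      |>.differentiableAt.differentiableWithinAt, by simp, ?_⟩
    exact (ih (contDiffOn_fderiv_comp_inl hV hH)).congr fun q hq =>
      (hasFDerivAt_intervalIntegral_of_contDiffOn hV hH a b hq).fderiv

end ParametricIntegral

namespace OddClassSymbol

noncomputable section

/-! ### Rotations generated by `J` with `J³ = -J` -/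

variable {n : ℕ} {J : E n →L[ℝ] E n}

/-- The one-parameter group generated by `J`, when `J³ = -J`. -/
def rot (J : E n →L[ℝ] E n) (θ : ℝ) : E n →L[ℝ] E n :=
  ContinuousLinearMap.id ℝ (E n) + (1 - Real.cos θ) • J.comp J + Real.sin θ • J

theorem rot_apply (J : E n →L[ℝ] E n) (θ : ℝ) (ξ : E n) :
    rot J θ ξ = ξ + (1 - Real.cos θ) • J (J ξ) + Real.sin θ • J ξ := rfl

attribute [irreducible] rot

theorem rot_add (hJ : ∀ ξ, J (J (J ξ)) = -J ξ) (θ φ : ℝ) (ξ : E n) :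
    rot J (θ + φ) ξ = rot J θ (rot J φ ξ) := by
  simp only [rot_apply, map_add, map_smul, hJ, map_neg, Real.cos_add, Real.sin_add]
  module

theorem rot_comm (J : E n →L[ℝ] E n) (θ : ℝ) (ξ : E n) : rot J θ (J ξ) = J (rot J θ ξ) := by
  simp only [rot_apply, map_add, map_smul]

theorem rot_zero (J : E n →L[ℝ] E n) (ξ : E n) : rot J 0 ξ = ξ := by simp [rot_apply]

theorem rot_two_pi (J : E n →L[ℝ] E n) (ξ : E n) : rot J (2 * Real.pi) ξ = ξ := by
  simp [rot_apply]

theorem rot_ne_zero (hJ : ∀ ξ, J (J (J ξ)) = -J ξ) (θ : ℝ) {ξ : E n} (hξ : ξ ≠ 0) :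
    rot J θ ξ ≠ 0 := by
  intro h
  have := rot_add hJ (-θ) θ ξ
  rw [h, map_zero, neg_add_cancel, rot_zero] at this
  exact hξ this

/-- By `J³ = -J`, both sides equal `cos θ J ξ + sin θ J² ξ`. -/
theorem hasDerivAt_rot (hJ : ∀ ξ, J (J (J ξ)) = -J ξ) (θ : ℝ) (ξ : E n) :
    HasDerivAt (fun θ => rot J θ ξ) (J (rot J θ ξ)) θ := by
  have h1 : HasDerivAt (fun θ => rot J θ ξ) ((-(-Real.sin θ)) • J (J ξ) + Real.cos θ • J ξ) θ := by
    simp only [rot_apply]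
    exact ((((Real.hasDerivAt_cos θ).const_sub 1).smul_const (J (J ξ))).const_add ξ).add
      ((Real.hasDerivAt_sin θ).smul_const (J ξ))
  convert h1 using 1
  simp only [rot_apply, map_add, map_smul, hJ]
  module

theorem contDiff_rot (J : E n →L[ℝ] E n) :
    ContDiff ℝ ∞ (fun q : E n × ℝ => rot J q.2 q.1) := by
  simp only [rot_apply]
  have h1 : ContDiff ℝ ∞ (fun q : E n × ℝ => J q.1) := J.contDiff.comp contDiff_fst
  have h2 : ContDiff ℝ ∞ (fun q : E n × ℝ => J (J q.1)) := J.contDiff.comp h1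
  have h3 : ContDiff ℝ ∞ (fun q : E n × ℝ => Real.cos q.2) := Real.contDiff_cos.comp contDiff_snd
  have h4 : ContDiff ℝ ∞ (fun q : E n × ℝ => Real.sin q.2) := Real.contDiff_sin.comp contDiff_snd
  exact (contDiff_fst.add ((contDiff_const.sub h3).smul h2)).add (h4.smul h1)

/-- The integral of a function over the rotations of the cotangent variable, with weight `w`. -/
def rotAvg (J : E n →L[ℝ] E n) (w : ℝ → ℂ) (T : ℝ) (f : E n × E n → ℂ) : E n × E n → ℂ :=
  fun p => ∫ θ in (0 : ℝ)..T, w θ * f (p.1, rot J θ p.2)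

variable {U : Set (E n)} {f : E n × E n → ℂ} {w : ℝ → ℂ}

theorem contDiffOn_weighted_rot (hJ : ∀ ξ, J (J (J ξ)) = -J ξ) (hw : ContDiff ℝ ∞ w)
    (hf : ContDiffOn ℝ ∞ f (U ×ˢ {ξ : E n | ξ ≠ 0})) :
    ContDiffOn ℝ ∞ (fun q : (E n × E n) × ℝ => w q.2 * f (q.1.1, rot J q.2 q.1.2))
      ((U ×ˢ {ξ : E n | ξ ≠ 0}) ×ˢ Set.univ) := by
  have h1 : ContDiff ℝ ∞ (fun q : (E n × E n) × ℝ => w q.2) := hw.comp contDiff_snd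
  have h2 : ContDiff ℝ ∞ (fun q : (E n × E n) × ℝ => ((q.1.2, q.2) : E n × ℝ)) := by fun_prop
  have h3 : ContDiff ℝ ∞ (fun q : (E n × E n) × ℝ => rot J q.2 q.1.2) := (contDiff_rot J).comp h2
  have h4 : ContDiff ℝ ∞ (fun q : (E n × E n) × ℝ => ((q.1.1, rot J q.2 q.1.2) : E n × E n)) :=
    (contDiff_fst.comp contDiff_fst).prodMk h3
  have h5 : Set.MapsTo (fun q : (E n × E n) × ℝ => ((q.1.1, rot J q.2 q.1.2) : E n × E n))
      ((U ×ˢ {ξ : E n | ξ ≠ 0}) ×ˢ Set.univ) (U ×ˢ {ξ : E n | ξ ≠ 0}) :=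
    fun q hq => mem_punctured hq.1.1 (rot_ne_zero hJ q.2 hq.1.2)
  exact h1.contDiffOn.mul (hf.comp h4.contDiffOn h5)

theorem isHomogeneousSymbol_rotAvg {d : ℂ} (hU : IsOpen U) (hJ : ∀ ξ, J (J (J ξ)) = -J ξ)
    (hw : ContDiff ℝ ∞ w) (T : ℝ) (hf : IsHomogeneousSymbol U d f) :
    IsHomogeneousSymbol U d (rotAvg J w T f) where
  smooth := contDiffOn_intervalIntegral (isOpen_punctured hU)
    (contDiffOn_weighted_rot hJ hw hf.smooth) 0 T
  homogeneous x hx ξ hξ t ht := by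
    simp only [rotAvg]
    rw [← intervalIntegral.integral_const_mul]
    refine intervalIntegral.integral_congr fun θ _ => ?_
    beta_reduce
    rw [_root_.map_smul, hf.homogeneous x hx _ (rot_ne_zero hJ θ hξ) t ht]
    ring

theorem rotAvg_neg (hJ : ∀ ξ, J (J (J ξ)) = -J ξ) (w : ℝ → ℂ) (T : ℝ)
    (hf : ∀ x ∈ U, ∀ ξ : E n, ξ ≠ 0 → f (x, -ξ) = -f (x, ξ)) {x : E n} (hx : x ∈ U) {ξ : E n}
    (hξ : ξ ≠ 0) : rotAvg J w T f (x, -ξ) = -rotAvg J w T f (x, ξ) := by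
  simp only [rotAvg]
  rw [← intervalIntegral.integral_neg]
  refine intervalIntegral.integral_congr fun θ _ => ?_
  beta_reduce
  rw [map_neg, hf x hx _ (rot_ne_zero hJ θ hξ), mul_neg]

/-- Rotating `ξ` shifts the interval of integration of a `2π`-periodic integrand. The constant
weight is essential for periodicity. -/
theorem rotAvg_rot (hJ : ∀ ξ, J (J (J ξ)) = -J ξ) (c : ℂ) (f : E n × E n → ℂ) (φ : ℝ)
    (x ξ : E n) :
    rotAvg J (fun _ => c) (2 * Real.pi) f (x, rot J φ ξ) =
      rotAvg J (fun _ => c) (2 * Real.pi) f (x, ξ) := by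
  simp only [rotAvg, ← rot_add hJ]
  rw [intervalIntegral.integral_comp_add_right (fun θ => c * f (x, rot J θ ξ)), zero_add, add_comm]
  have hper : Function.Periodic (fun θ => c * f (x, rot J θ ξ)) (2 * Real.pi) := by
    intro θ
    simp only [rot_apply, Real.cos_add_two_pi, Real.sin_add_two_pi]
  have := hper.intervalIntegral_add_eq φ 0
  rwa [zero_add] at this

/-- The derivative of a rotation average along the generator of the rotations. -/
theorem fderiv_rotAvg_generator {w' : ℝ → ℂ} (hU : IsOpen U) (hJ : ∀ ξ, J (J (J ξ)) = -J ξ)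
    (hw : ContDiff ℝ ∞ w) (hw' : ∀ θ, HasDerivAt w (w' θ) θ) (hwc : Continuous w') (T : ℝ)
    (hf : ContDiffOn ℝ ∞ f (U ×ˢ {ξ : E n | ξ ≠ 0})) {x ξ : E n} (hx : x ∈ U) (hξ : ξ ≠ 0) :
    fderiv ℝ (rotAvg J w T f) (x, ξ) (0, J ξ) =
      w T * f (x, rot J T ξ) - w 0 * f (x, ξ) - rotAvg J w' T f (x, ξ) := by
  have hV := isOpen_punctured (n := n) hU
  have hmem : (x, ξ) ∈ U ×ˢ {ξ : E n | ξ ≠ 0} := mem_punctured hx hξ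
  have hH := contDiffOn_weighted_rot hJ hw hf
  have hDc := continuous_slice (contDiffOn_fderiv_comp_inl hV hH).continuousOn hmem
  have hfd : ∀ θ, DifferentiableAt ℝ f (x, rot J θ ξ) := fun θ =>
    differentiableAt_of_contDiffOn hV hf (mem_punctured hx (rot_ne_zero hJ θ hξ))
  let g' : ℝ → ℂ := fun θ => fderiv ℝ f (x, rot J θ ξ) (0, J (rot J θ ξ))
  have hg : ∀ θ, HasDerivAt (fun θ => f (x, rot J θ ξ)) (g' θ) θ := fun θ =>
    (hfd θ).hasFDerivAt.comp_hasDerivAt θ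
      (HasDerivAt.prodMk (hasDerivAt_const θ x) (hasDerivAt_rot hJ θ ξ))
  have hg'c : Continuous g' := by
    have h1 : Continuous fun θ => rot J θ ξ :=
      (contDiff_rot J).continuous.comp (Continuous.prodMk continuous_const continuous_id)
    have h2 : Continuous fun θ => fderiv ℝ f (x, rot J θ ξ) := by
      have h3 : ContinuousOn (fderiv ℝ f) (U ×ˢ {ξ : E n | ξ ≠ 0}) :=
        ((contDiffOn_infty_iff_fderiv_of_isOpen hV).1 hf).2.continuousOn
      exact h3.comp_continuous (continuous_const.prodMk h1) fun θ =>
        mem_punctured hx (rot_ne_zero hJ θ hξ)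
    exact h2.clm_apply (continuous_const.prodMk (J.continuous.comp h1))
  -- Since `rot J θ` commutes with `J`, moving `ξ` along `J ξ` differentiates `f` along its orbit,
  -- that is, in `θ`. Integration by parts in `θ` then gives the formula.
  have hpt : ∀ θ, (fderiv ℝ (fun q : (E n × E n) × ℝ => w q.2 * f (q.1.1, rot J q.2 q.1.2))
      ((x, ξ), θ)).comp (ContinuousLinearMap.inl ℝ (E n × E n) ℝ) (0, J ξ) = w θ * g' θ := by
    intro θ
    have h1 := hasFDerivAt_slice hV hH hmem θ
    have h2 : HasFDerivAt (fun q : E n × E n => f (q.1, rot J θ q.2))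
        ((fderiv ℝ f (x, rot J θ ξ)).comp
          ((ContinuousLinearMap.id ℝ (E n)).prodMap (rot J θ))) (x, ξ) :=
      HasFDerivAt.comp (x, ξ) (g := f) (f := (ContinuousLinearMap.id ℝ (E n)).prodMap (rot J θ))
        (hfd θ).hasFDerivAt (ContinuousLinearMap.hasFDerivAt _)
    rw [h1.unique (h2.const_mul (w θ))]
    simp [g', rot_comm]
  have h1 := hasFDerivAt_intervalIntegral_of_contDiffOn hV hH 0 T hmem
  have h2 : fderiv ℝ (rotAvg J w T f) (x, ξ) = _ := h1.fderiv
  rw [h2, ContinuousLinearMap.intervalIntegral_apply (hDc.intervalIntegrable _ _)]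
  simp only [hpt]
  rw [intervalIntegral.integral_mul_deriv_eq_deriv_mul (fun θ _ => hw' θ) (fun θ _ => hg θ)
    (hwc.intervalIntegrable _ _) (hg'c.intervalIntegrable _ _), rot_zero]
  rfl

end

end OddClassSymbol

namespace OddClassSymbol

noncomputable section

/-! ### Vector fields `A ξ · G` with `A` linear -/

variable {n : ℕ} {U : Set (E n)} {f G : E n × E n → ℂ} {k : ℤ}

/-- The `i`-th component of the vector field `(x, ξ) ↦ G(x, ξ) A ξ`. -/
def linField (A : E n →L[ℝ] E n) (G : E n × E n → ℂ) (i : Fin n) : E n × E n → ℂ :=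
  fun p => ((A p.2 i : ℝ) : ℂ) * G p

/-- The `i`-th coordinate of `A ξ`, as a linear map of `(x, ξ)`. -/
def coordCLM (A : E n →L[ℝ] E n) (i : Fin n) : (E n × E n) →L[ℝ] ℂ :=
  Complex.ofRealCLM.comp ((EuclideanSpace.proj i).comp
    (A.comp (ContinuousLinearMap.snd ℝ (E n) (E n))))

theorem coordCLM_apply (A : E n →L[ℝ] E n) (i : Fin n) (p : E n × E n) :
    coordCLM A i p = ((A p.2 i : ℝ) : ℂ) := rfl

theorem linField_eq (A : E n →L[ℝ] E n) (G : E n × E n → ℂ) (i : Fin n) :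
    linField A G i = fun p => coordCLM A i p * G p := rfl

theorem isHomogeneousSymbol_linField (A : E n →L[ℝ] E n) (hG : IsHomogeneousSymbol U (k : ℂ) G)
    (i : Fin n) : IsHomogeneousSymbol U ((k + 1 : ℤ) : ℂ) (linField A G i) where
  smooth := by
    rw [linField_eq]
    exact (coordCLM A i).contDiff.contDiffOn.mul hG.smooth
  homogeneous x hx ξ hξ t ht := by
    have htc : (t : ℂ) ≠ 0 := by exact_mod_cast ht.ne'
    simp only [linField]
    rw [hG.map_smul hx hξ ht, Complex.cpow_intCast, zpow_add_one₀ htc, _root_.map_smul,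
      PiLp.smul_apply, smul_eq_mul]
    push_cast
    ring

theorem linField_neg (A : E n →L[ℝ] E n) {c : ℂ} {x ξ : E n} (hG : G (x, -ξ) = c * G (x, ξ))
    (i : Fin n) : linField A G i (x, -ξ) = -c * linField A G i (x, ξ) := by
  simp only [linField, map_neg, PiLp.neg_apply, hG]
  push_cast
  ring

/-- The divergence of `G A ξ` is `tr(A) G + (A ξ · ∂_ξ) G`. -/
theorem sum_partialXi_linField (A : E n →L[ℝ] E n) {p : E n × E n}
    (hG : DifferentiableAt ℝ G p) :
    ∑ i, partialXi i (linField A G i) p =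
      ((∑ i, A (EuclideanSpace.single i 1) i : ℝ) : ℂ) * G p + fderiv ℝ G p (0, A p.2) := by
  have h1 : ∀ i, partialXi i (linField A G i) p =
      ((A (EuclideanSpace.single i 1) i : ℝ) : ℂ) * G p +
        (A p.2 i) • fderiv ℝ G p (0, EuclideanSpace.single i 1) := by
    intro i
    simp only [partialXi, linField_eq]
    rw [((coordCLM A i).hasFDerivAt.fun_mul hG.hasFDerivAt).fderiv]
    simp [coordCLM_apply]
    ring
  have h2 : ((0, A p.2) : E n × E n) =
      ∑ i, (A p.2 i) • ((0, EuclideanSpace.single i 1) : E n × E n) := by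
    refine Prod.ext ?_ ?_
    · simp [Prod.fst_sum]
    · simp only [Prod.snd_sum, Prod.smul_snd]
      ext j
      simp [Finset.sum_apply, Pi.single_apply]
  rw [Finset.sum_congr rfl fun i _ => h1 i, Finset.sum_add_distrib, h2, map_sum]
  simp only [_root_.map_smul]
  push_cast
  rw [Finset.sum_mul]

/-- Euler's identity. -/
theorem IsHomogeneousSymbol.fderiv_radial (hU : IsOpen U) (hf : IsHomogeneousSymbol U (k : ℂ) f)
    {x ξ : E n} (hx : x ∈ U) (hξ : ξ ≠ 0) : fderiv ℝ f (x, ξ) (0, ξ) = k * f (x, ξ) := by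
  have hd : HasFDerivAt f (fderiv ℝ f (x, ξ)) (x, (1 : ℝ) • ξ) := by
    rw [one_smul]
    exact (differentiableAt_of_contDiffOn (isOpen_punctured hU) hf.smooth
      (mem_punctured hx hξ)).hasFDerivAt
  have hline : HasDerivAt (fun t : ℝ => ((x, t • ξ) : E n × E n)) (0, (1 : ℝ) • ξ) 1 :=
    HasDerivAt.prodMk (hasDerivAt_const 1 x) ((hasDerivAt_id (1 : ℝ)).smul_const ξ)
  have h1 : HasDerivAt (fun t : ℝ => f (x, t • ξ)) (fderiv ℝ f (x, ξ) (0, (1 : ℝ) • ξ)) 1 :=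
    hd.comp_hasDerivAt 1 hline
  have h2 : HasDerivAt (fun t : ℝ => (t : ℂ) ^ k * f (x, ξ)) (k * f (x, ξ)) 1 := by
    have h3 := (hasDerivAt_zpow k (1 : ℂ) (Or.inl one_ne_zero))
    have h4 : HasDerivAt (fun t : ℝ => (t : ℂ) ^ k) ((k : ℂ) * 1 ^ (k - 1) * 1) 1 :=
      HasDerivAt.comp (1 : ℝ) (h₂ := fun z : ℂ => z ^ k) (h := fun t : ℝ => (t : ℂ))
        (by simpa using h3) (Complex.ofRealCLM.hasDerivAt)
    simpa using h4.mul_const (f (x, ξ))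
  have h5 : (fun t : ℝ => f (x, t • ξ)) =ᶠ[nhds 1] fun t : ℝ => (t : ℂ) ^ k * f (x, ξ) := by
    filter_upwards [lt_mem_nhds (zero_lt_one (α := ℝ))] with t ht
    exact hf.map_smul hx hξ ht
  have := h1.unique (h2.congr_of_eventuallyEq h5)
  rwa [one_smul] at this

/-! ### Signed permutations of the coordinates -/

/-- The linear map with `(J ξ)_i = ε_i ξ_{s(i)}`. -/
def signedPerm (ε : Fin n → ℝ) (s : Fin n → Fin n) : E n →L[ℝ] E n :=
  LinearMap.toContinuousLinearMap
    { toFun := fun ξ => WithLp.toLp 2 fun i => ε i * ξ (s i)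
      map_add' := fun ξ η => by ext i; simp [mul_add]
      map_smul' := fun c ξ => by ext i; simp [mul_left_comm] }

theorem signedPerm_apply (ε : Fin n → ℝ) (s : Fin n → Fin n) (ξ : E n) (i : Fin n) :
    signedPerm ε s ξ i = ε i * ξ (s i) := rfl

section SignedPerm

variable {ε : Fin n → ℝ} {s : Fin n → Fin n}

theorem signedPerm_sq_apply (hs : ∀ i, s (s i) = i) (hεs : ∀ i, ε (s i) = -ε i) (ξ : E n)
    (i : Fin n) : signedPerm ε s (signedPerm ε s ξ) i = -(ε i) ^ 2 * ξ i := by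
  rw [signedPerm_apply, signedPerm_apply, hs, hεs]
  ring

/-- The square is diagonal with entries `-(ε i) ^ 2`, and `ε i ^ 3 = ε i` makes each of them `0` or
`-1`. -/
theorem signedPerm_cube (hs : ∀ i, s (s i) = i) (hεs : ∀ i, ε (s i) = -ε i)
    (hε : ∀ i, ε i ^ 3 = ε i) (ξ : E n) :
    signedPerm ε s (signedPerm ε s (signedPerm ε s ξ)) = -signedPerm ε s ξ := by
  ext i
  rw [signedPerm_sq_apply hs hεs, PiLp.neg_apply, signedPerm_apply]
  linear_combination (-ξ (s i)) * hε i

theorem signedPerm_diag (hεs : ∀ i, ε (s i) = -ε i) (i : Fin n) :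
    signedPerm ε s (EuclideanSpace.single i 1) i = 0 := by
  rw [signedPerm_apply]
  by_cases h : s i = i
  · have := hεs i
    rw [h] at this
    have : ε i = 0 := by linarith
    simp [this]
  · simp [h]

theorem rot_signedPerm_apply (hs : ∀ i, s (s i) = i) (hεs : ∀ i, ε (s i) = -ε i) (θ : ℝ)
    (ξ : E n) (i : Fin n) :
    rot (signedPerm ε s) θ ξ i =
      ξ i - (1 - Real.cos θ) * ε i ^ 2 * ξ i + Real.sin θ * (ε i * ξ (s i)) := by
  rw [rot_apply, PiLp.add_apply, PiLp.add_apply, PiLp.smul_apply, PiLp.smul_apply,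
    signedPerm_sq_apply hs hεs, signedPerm_apply]
  simp only [smul_eq_mul]
  ring

end SignedPerm

/-- A vector of the plane is rotated to its mirror image. -/
theorem exists_rotation_eq_reflection (u v : ℝ) :
    ∃ φ : ℝ, Real.cos φ * u - Real.sin φ * v = -u ∧ Real.cos φ * v + Real.sin φ * u = v := by
  set z : ℂ := ⟨u, v⟩
  set a : ℝ := z.arg
  have hu : ‖z‖ * Real.cos a = u := Complex.norm_mul_cos_arg z
  have hv : ‖z‖ * Real.sin a = v := Complex.norm_mul_sin_arg z
  -- Reflection in the vertical axis takes the polar angle `a` to `π - a`.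
  refine ⟨Real.pi - 2 * a, ?_, ?_⟩ <;>
  · rw [Real.cos_pi_sub, Real.sin_pi_sub, Real.cos_two_mul, Real.sin_two_mul, ← hu, ← hv]
    have := Real.sin_sq_add_cos_sq a
    first
    | linear_combination (-2 * ‖z‖ * Real.cos a) * this
    | linear_combination (0 : ℝ) * this

/-! ### Rotations in odd dimension -/

/-- In odd dimension at least `3` there are two rotation generators such that the first rotates
every vector `ξ` to its mirror image in the first coordinate, which the second one rotates by the
angle `π` to `-ξ`. -/
theorem exists_generators (hn : Odd n) (hn3 : 3 ≤ n) :
    ∃ J J' : E n →L[ℝ] E n,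
      (∀ ξ, J (J (J ξ)) = -J ξ) ∧ (∀ i, J (EuclideanSpace.single i 1) i = 0) ∧
      (∀ ξ, J' (J' (J' ξ)) = -J' ξ) ∧ (∀ i, J' (EuclideanSpace.single i 1) i = 0) ∧
      ∀ ξ, ∃ φ, rot J' Real.pi ξ = -rot J φ ξ := by
  let i0 : Fin n := ⟨0, by omega⟩
  let i1 : Fin n := ⟨1, by omega⟩
  have h01 : i0 ≠ i1 := by simp [i0, i1, Fin.ext_iff]
  -- `J` rotates the plane of the first two coordinates and annihilates the others.
  let ε : Fin n → ℝ := fun i => if i = i0 then -1 else if i = i1 then 1 else 0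
  let s : Fin n → Fin n := Equiv.swap i0 i1
  have hs : ∀ i, s (s i) = i := fun i => Equiv.swap_apply_self i0 i1 i
  have hεs : ∀ i, ε (s i) = -ε i := by
    intro i
    by_cases h0 : i = i0
    · simp [ε, s, h0, h01.symm]
    by_cases h1 : i = i1
    · simp [ε, s, h1, h01.symm]
    · simp [ε, s, h0, h1, Equiv.swap_apply_of_ne_of_ne h0 h1]
  have hε3 : ∀ i, ε i ^ 3 = ε i := by
    intro i
    simp only [ε]
    split_ifs <;> norm_num
  -- `J'` annihilates coordinate `0` and rotates the planes `(1, 2), (3, 4), …`; these exhaust the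
  -- remaining coordinates because `n` is odd. Its half turn fixes coordinate `0` and negates all
  -- others.
  let ε' : Fin n → ℝ := fun i => if i.1 = 0 then 0 else if i.1 % 2 = 1 then -1 else 1
  let s' : Fin n → Fin n := fun i => if i.1 = 0 then i else
    if h : i.1 % 2 = 1 then ⟨i.1 + 1, by obtain ⟨m, hm⟩ := hn; have := i.2; omega⟩
    else ⟨i.1 - 1, by have := i.2; omega⟩
  have hs' : ∀ i, s' (s' i) = i := by
    intro i
    by_cases h0 : i.1 = 0
    · simp [s', h0]
    by_cases h1 : i.1 % 2 = 1
    · have e : (i.1 + 1) % 2 ≠ 1 := by omega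
      simp [s', h0, h1, e]
    · have e1 : i.1 - 1 ≠ 0 := by omega
      have e2 : (i.1 - 1) % 2 = 1 := by omega
      have e3 : i.1 - 1 + 1 = i.1 := by omega
      simp [s', h0, h1, e1, e2, e3]
  have hεs' : ∀ i, ε' (s' i) = -ε' i := by
    intro i
    by_cases h0 : i.1 = 0
    · simp [ε', s', h0]
    by_cases h1 : i.1 % 2 = 1
    · have e : (i.1 + 1) % 2 ≠ 1 := by omega
      simp [ε', s', h0, h1, e]
    · have e1 : i.1 - 1 ≠ 0 := by omega
      have e2 : (i.1 - 1) % 2 = 1 := by omega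
      simp [ε', s', h0, h1, e1, e2]
  have hε3' : ∀ i, ε' i ^ 3 = ε' i := by
    intro i
    simp only [ε']
    split_ifs <;> norm_num
  refine ⟨signedPerm ε s, signedPerm ε' s', signedPerm_cube hs hεs hε3, signedPerm_diag hεs,
    signedPerm_cube hs' hεs' hε3', signedPerm_diag hεs', fun ξ => ?_⟩
  obtain ⟨φ, hφ1, hφ2⟩ := exists_rotation_eq_reflection (ξ i0) (ξ i1)
  refine ⟨φ, ?_⟩
  ext i
  rw [PiLp.neg_apply, rot_signedPerm_apply hs' hεs', rot_signedPerm_apply hs hεs, Real.cos_pi,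
    Real.sin_pi]
  by_cases h0 : i = i0
  · subst h0
    have e1 : ε i0 = -1 := by simp [ε]
    have e2 : s i0 = i1 := by simp [s]
    have e3 : ε' i0 = 0 := by simp [ε', i0]
    rw [e1, e2, e3]
    linear_combination hφ1
  · have e3 : ε' i ^ 2 = 1 := by
      have : i.1 ≠ 0 := fun h => h0 (Fin.ext h)
      simp only [ε', if_neg this]
      split_ifs <;> norm_num
    by_cases h1 : i = i1
    · subst h1
      have e1 : ε i1 = 1 := by simp [ε, h01.symm]
      have e2 : s i1 = i0 := by simp [s]
      rw [e3, e1, e2]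
      linear_combination hφ2
    · have e1 : ε i = 0 := by simp [ε, h0, h1]
      rw [e3, e1]
      ring

/-! ### Homogeneous functions as divergences -/

theorem sum_partialXi_linField_of_diag_eq_zero {J : E n →L[ℝ] E n}
    (hJ : ∀ i, J (EuclideanSpace.single i 1) i = 0) {p : E n × E n}
    (hG : DifferentiableAt ℝ G p) :
    ∑ i, partialXi i (linField J G i) p = fderiv ℝ G p (0, J p.2) := by
  rw [sum_partialXi_linField J hG]
  simp [hJ]

/-- The radial field `ξ f / (n + k)` works: the trace contributes `n` and Euler's identity `k`. -/
theorem exists_antidivergence_of_ne (hU : IsOpen U) (hf : IsHomogeneousSymbol U (k : ℂ) f)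
    (hpar : ∀ x ∈ U, ∀ ξ : E n, ξ ≠ 0 → f (x, -ξ) = (-1) ^ k * f (x, ξ))
    (hk : (n : ℤ) + k ≠ 0) :
    ∃ g : Fin n → E n × E n → ℂ, (∀ i, IsHomogeneousSymbol U ((k + 1 : ℤ) : ℂ) (g i)) ∧
      (∀ i, ∀ x ∈ U, ∀ ξ : E n, ξ ≠ 0 → g i (x, -ξ) = (-1) ^ (k + 1) * g i (x, ξ)) ∧
      ∀ x ∈ U, ∀ ξ : E n, ξ ≠ 0 → ∑ i, partialXi i (g i) (x, ξ) = f (x, ξ) := by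
  have hc : (n : ℂ) + k ≠ 0 := by exact_mod_cast hk
  let G : E n × E n → ℂ := fun p => ((n : ℂ) + k)⁻¹ * f p
  have hG : IsHomogeneousSymbol U (k : ℂ) G :=
    ⟨contDiffOn_const.mul hf.smooth, fun x hx ξ hξ t ht => by
      simp only [G, hf.homogeneous x hx ξ hξ t ht]; ring⟩
  refine ⟨linField (ContinuousLinearMap.id ℝ (E n)) G, isHomogeneousSymbol_linField _ hG,
    fun i x hx ξ hξ => ?_, fun x hx ξ hξ => ?_⟩
  · rw [linField_neg _ (c := (-1) ^ k) (by simp only [G, hpar x hx ξ hξ]; ring),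
      zpow_add_one₀ (by norm_num)]
    ring
  · rw [sum_partialXi_linField _ (differentiableAt_of_contDiffOn (isOpen_punctured hU) hG.smooth
      (mem_punctured hx hξ)), ContinuousLinearMap.id_apply, hG.fderiv_radial hU hx hξ]
    simp only [ContinuousLinearMap.id_apply, PiLp.single_apply, if_true, Finset.sum_const,
      Finset.card_univ, Fintype.card_fin, nsmul_eq_mul, mul_one, Complex.ofReal_natCast, G]
    field_simp

/-- In odd dimension at least `3`, an odd function that is homogeneous of the critical degree `-n`
is the divergence of a vector field that is homogeneous of degree `1 - n`. -/
theorem exists_antidivergence_of_odd (hn : Odd n) (hn3 : 3 ≤ n) (hU : IsOpen U)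
    (hf : IsHomogeneousSymbol U (k : ℂ) f)
    (hodd : ∀ x ∈ U, ∀ ξ : E n, ξ ≠ 0 → f (x, -ξ) = -f (x, ξ)) :
    ∃ g : Fin n → E n × E n → ℂ, (∀ i, IsHomogeneousSymbol U ((k + 1 : ℤ) : ℂ) (g i)) ∧
      (∀ i, ∀ x ∈ U, ∀ ξ : E n, ξ ≠ 0 → g i (x, -ξ) = g i (x, ξ)) ∧
      ∀ x ∈ U, ∀ ξ : E n, ξ ≠ 0 → ∑ i, partialXi i (g i) (x, ξ) = f (x, ξ) := by
  obtain ⟨J, J', hJ, hJd, hJ', hJd', hrot⟩ := exists_generators hn hn3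
  have hpi : (Real.pi : ℂ) ≠ 0 := by exact_mod_cast Real.pi_ne_zero
  let c : ℂ := (2 * (Real.pi : ℂ))⁻¹
  have hw1 : ContDiff ℝ ∞ (fun θ : ℝ => c * (θ : ℂ)) :=
    contDiff_const.mul Complex.ofRealCLM.contDiff
  have hw1' : ∀ θ : ℝ, HasDerivAt (fun θ : ℝ => c * (θ : ℂ)) c θ := fun θ => by
    simpa using (Complex.ofRealCLM.hasDerivAt (x := θ)).const_mul c
  -- The weight `θ / 2π` of `G` runs from `0` to `1` with derivative `c`: the boundary terms give
  -- `f` and the remaining integral gives `f₁`. For `G'` the weight is constant, so only the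
  -- boundary terms `-(1/2) (f₁ (rot J' π ξ) - f₁ ξ)` remain.
  let f₁ := rotAvg J (fun _ => c) (2 * Real.pi) f
  let G := rotAvg J (fun θ => c * (θ : ℂ)) (2 * Real.pi) f
  let G' := rotAvg J' (fun _ => -(1 / 2 : ℂ)) Real.pi f₁
  have hf₁ : IsHomogeneousSymbol U (k : ℂ) f₁ :=
    isHomogeneousSymbol_rotAvg hU hJ contDiff_const _ hf
  have hG : IsHomogeneousSymbol U (k : ℂ) G := isHomogeneousSymbol_rotAvg hU hJ hw1 _ hf
  have hG' : IsHomogeneousSymbol U (k : ℂ) G' :=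
    isHomogeneousSymbol_rotAvg hU hJ' contDiff_const _ hf₁
  have hodd₁ : ∀ x ∈ U, ∀ ξ : E n, ξ ≠ 0 → f₁ (x, -ξ) = -f₁ (x, ξ) := fun x hx ξ hξ =>
    rotAvg_neg hJ _ _ hodd hx hξ
  have hdG : ∀ x ∈ U, ∀ ξ : E n, ξ ≠ 0 →
      fderiv ℝ G (x, ξ) (0, J ξ) = f (x, ξ) - f₁ (x, ξ) := by
    intro x hx ξ hξ
    rw [fderiv_rotAvg_generator hU hJ hw1 hw1' continuous_const _ hf.smooth hx hξ, rot_two_pi]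
    have : c * ((2 * Real.pi : ℝ) : ℂ) = 1 := by
      simp only [c]
      push_cast
      exact inv_mul_cancel₀ (mul_ne_zero two_ne_zero hpi)
    rw [this]
    simp [f₁]
  have hdG' : ∀ x ∈ U, ∀ ξ : E n, ξ ≠ 0 → fderiv ℝ G' (x, ξ) (0, J' ξ) = f₁ (x, ξ) := by
    intro x hx ξ hξ
    rw [fderiv_rotAvg_generator hU hJ' contDiff_const (fun θ => hasDerivAt_const θ _)
      continuous_const _ hf₁.smooth hx hξ]
    -- `φ` may depend on `ξ`, as `f₁` is invariant under every `rot J φ`. With oddness, the half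
    -- turn of `J'` sends `f₁` to `-f₁`.
    obtain ⟨φ, hφ⟩ := hrot ξ
    have e : f₁ (x, rot J φ ξ) = f₁ (x, ξ) := rotAvg_rot hJ c f φ x ξ
    rw [hφ, hodd₁ x hx _ (rot_ne_zero hJ φ hξ), e]
    simp only [rotAvg, zero_mul, intervalIntegral.integral_zero]
    ring
  have h1 := isHomogeneousSymbol_linField J hG
  have h2 := isHomogeneousSymbol_linField J' hG'
  have hsmall : ∀ {g : E n × E n → ℂ} {d : ℂ}, IsHomogeneousSymbol U d g → ∀ x ∈ U,
      ∀ ξ : E n, ξ ≠ 0 → DifferentiableAt ℝ g (x, ξ) := fun hg x hx ξ hξ =>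
    differentiableAt_of_contDiffOn (isOpen_punctured hU) hg.smooth (mem_punctured hx hξ)
  refine ⟨fun i p => linField J G i p + linField J' G' i p,
    fun i => ⟨(h1 i).smooth.add (h2 i).smooth, fun x hx ξ hξ t ht => ?_⟩,
    fun i x hx ξ hξ => ?_, fun x hx ξ hξ => ?_⟩
  · beta_reduce
    rw [(h1 i).homogeneous x hx ξ hξ t ht, (h2 i).homogeneous x hx ξ hξ t ht]
    ring
  · have e1 : G (x, -ξ) = (-1) * G (x, ξ) := by
      rw [neg_one_mul]
      exact rotAvg_neg hJ _ _ hodd hx hξ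
    have e2 : G' (x, -ξ) = (-1) * G' (x, ξ) := by
      rw [neg_one_mul]
      exact rotAvg_neg hJ' _ _ hodd₁ hx hξ
    beta_reduce
    rw [linField_neg J e1, linField_neg J' e2]
    ring
  · have e : ∀ i, partialXi i (fun p => linField J G i p + linField J' G' i p) (x, ξ) =
        partialXi i (linField J G i) (x, ξ) + partialXi i (linField J' G' i) (x, ξ) := by
      intro i
      simp only [partialXi]
      rw [fderiv_fun_add (hsmall (h1 i) x hx ξ hξ) (hsmall (h2 i) x hx ξ hξ)]
      rfl
    rw [Finset.sum_congr rfl fun i _ => e i, Finset.sum_add_distrib,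
      sum_partialXi_linField_of_diag_eq_zero hJd (hsmall hG x hx ξ hξ),
      sum_partialXi_linField_of_diag_eq_zero hJd' (hsmall hG' x hx ξ hξ), hdG x hx ξ hξ,
      hdG' x hx ξ hξ]
    ring

/-- A homogeneous function of degree `k` and parity `(-1)^k` is a divergence of homogeneous
functions of degree `k + 1` and parity `(-1)^(k + 1)`, in odd dimension. -/
theorem exists_antidivergence (hn : Odd n) (hU : IsOpen U) (hk : n = 1 → k ≠ -1)
    (hf : IsHomogeneousSymbol U (k : ℂ) f)
    (hpar : ∀ x ∈ U, ∀ ξ : E n, ξ ≠ 0 → f (x, -ξ) = (-1) ^ k * f (x, ξ)) :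
    ∃ g : Fin n → E n × E n → ℂ, (∀ i, IsHomogeneousSymbol U ((k + 1 : ℤ) : ℂ) (g i)) ∧
      (∀ i, ∀ x ∈ U, ∀ ξ : E n, ξ ≠ 0 → g i (x, -ξ) = (-1) ^ (k + 1) * g i (x, ξ)) ∧
      ∀ x ∈ U, ∀ ξ : E n, ξ ≠ 0 → ∑ i, partialXi i (g i) (x, ξ) = f (x, ξ) := by
  by_cases hkn : (n : ℤ) + k = 0
  -- In the critical degree `k = -n`, the value `n = 1` would mean `k = -1`, which `hk` excludes.
  · have hn3 : 3 ≤ n := by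
      obtain ⟨m, hm⟩ := hn
      by_contra hlt
      exact hk (by omega) (by omega)
    have hkodd : Odd k := by
      obtain ⟨m, hm⟩ := hn
      exact ⟨-(m : ℤ) - 1, by omega⟩
    obtain ⟨g, hg1, hg2, hg3⟩ := exists_antidivergence_of_odd hn hn3 hU hf fun x hx ξ hξ => by
      rw [hpar x hx ξ hξ, hkodd.neg_one_zpow, neg_one_mul]
    refine ⟨g, hg1, fun i x hx ξ hξ => ?_, hg3⟩
    rw [hg2 i x hx ξ hξ, hkodd.add_one.neg_one_zpow, one_mul]
  · exact exists_antidivergence_of_ne hU hf hpar hkn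

/-- Rescaling to the unit sphere carries the relation from `‖ξ‖ ≥ 1` to all `ξ ≠ 0`. -/
theorem IsHomogeneousSymbol.parity (hf : IsHomogeneousSymbol U (k : ℂ) f) {c : ℂ}
    (hpar : ∀ x ∈ U, ∀ ξ : E n, 1 ≤ ‖ξ‖ → f (x, -ξ) = c * f (x, ξ)) {x : E n} (hx : x ∈ U)
    {ξ : E n} (hξ : ξ ≠ 0) : f (x, -ξ) = c * f (x, ξ) := by
  have hpos : 0 < ‖ξ‖ := norm_pos_iff.2 hξ
  have hinv : 0 < ‖ξ‖⁻¹ := inv_pos.2 hpos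
  have h := hpar x hx (‖ξ‖⁻¹ • ξ) (by
    rw [norm_smul, norm_inv, norm_norm, inv_mul_cancel₀ hpos.ne'])
  rw [← smul_neg, hf.map_smul hx (neg_ne_zero.2 hξ) hinv, hf.map_smul hx hξ hinv,
    mul_left_comm] at h
  exact mul_left_cancel₀ (zpow_ne_zero _ (by exact_mod_cast hinv.ne')) h

/-! ### Divergences of classical symbols -/

theorem partialXi_cutoff_mul_eq {ψ : E n → ℝ} (hψ : IsCutoff ψ) (g : E n × E n → ℂ) (i : Fin n)
    {p : E n × E n} (hp : 1 < ‖p.2‖) :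
    partialXi i (fun p : E n × E n => (ψ p.2 : ℂ) * g p) p = partialXi i g p := by
  have hW : IsOpen {p : E n × E n | 1 < ‖p.2‖} :=
    isOpen_lt continuous_const (by fun_prop)
  have : (fun p : E n × E n => (ψ p.2 : ℂ) * g p) =ᶠ[nhds p] g := by
    filter_upwards [hW.mem_nhds hp] with q hq
    simp [hψ.eq_one q.2 (le_of_lt hq)]
  simp only [partialXi, this.fderiv_eq]

/-- If the components of `σ` are the divergences of those of `τ`, then `σ` is the divergence of
`τ` up to a smoothing symbol. -/
theorem isSmoothing_sub_divergence (hU : IsOpen U) {a : ℤ} {σ : E n × E n → ℂ}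
    {h : ℕ → E n × E n → ℂ} (hσ : HasClassicalExpansion U a σ h) {τ : Fin n → E n × E n → ℂ}
    {g : ℕ → Fin n → E n × E n → ℂ}
    (hτ : ∀ i, HasClassicalExpansion U ((a + 1 : ℤ) : ℂ) (τ i) (fun j => g j i))
    (hdiv : ∀ j, ∀ x ∈ U, ∀ ξ : E n, ξ ≠ 0 → ∑ i, partialXi i (g j i) (x, ξ) = h j (x, ξ)) :
    IsSmoothing U (fun p => σ p - ∑ i, partialXi i (τ i) p) := by
  obtain ⟨ψ, hψ⟩ := exists_isCutoff n
  have hV := isOpen_prod_univ (n := n) hU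
  intro b
  obtain ⟨N, hN⟩ := exists_nat_ge ((a : ℝ) - b.re)
  refine IsSymbol.mono (a := (a : ℂ) - N) ?_ (by simp; linarith)
  have hgs : ∀ i j, ContDiffOn ℝ ∞ (fun p : E n × E n => (ψ p.2 : ℂ) * g j i p) (U ×ˢ Set.univ) :=
    fun i j => hψ.contDiffOn_mul hU ((hτ i).component j).smooth
  have h1 := (hσ.expansion ψ hψ).remainder N
  -- The remainder of `τ i` has order `a + 1 - N`; the derivative lowers it to `a - N`.
  have h2 : IsSymbol U ((a : ℂ) - N) (fun p => ∑ i, partialXi i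
      (fun p => τ i p - ∑ j ∈ Finset.range N, (ψ p.2 : ℂ) * g j i p) p) := by
    refine IsSymbol.sum hU _ fun i _ => ?_
    refine ((((hτ i).expansion ψ hψ).remainder N).partialXi hU i).mono ?_
    simp
    linarith
  -- For `‖ξ‖ > 1` the cut-off is locally `1` and `hdiv` makes each summand vanish.
  have h3 : IsSymbol U ((a : ℂ) - N) (fun p : E n × E n => ∑ j ∈ Finset.range N,
      ((ψ p.2 : ℂ) * h j p - ∑ i, partialXi i (fun p => (ψ p.2 : ℂ) * g j i p) p)) := by
    refine IsSymbol.sum hU _ fun j _ => isSmoothing_of_eq_zero hU ?_ 1 (fun x hx ξ hξ => ?_) _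
    · exact (hψ.contDiffOn_mul hU (hσ.component j).smooth).sub
        (ContDiffOn.sum fun i _ => contDiffOn_fderiv_apply hV (hgs i j) _)
    · have hξ0 : ξ ≠ 0 := norm_pos_iff.1 (one_pos.trans hξ)
      rw [Finset.sum_congr rfl fun i _ => partialXi_cutoff_mul_eq hψ (g j i) i (p := (x, ξ)) hξ,
        hdiv j x hx ξ hξ0, hψ.eq_one ξ hξ.le]
      simp
  refine ((h1.add hU h3).sub hU h2).congr hU fun p hp => ?_
  have hτs : ∀ i, DifferentiableAt ℝ (τ i) p := by
    intro i
    have := (((hτ i).expansion ψ hψ).remainder 0).smooth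
    simp only [Finset.range_zero, Finset.sum_empty, sub_zero] at this
    exact differentiableAt_of_contDiffOn hV this hp
  have e : ∀ i, partialXi i (fun p => τ i p - ∑ j ∈ Finset.range N, (ψ p.2 : ℂ) * g j i p) p =
      partialXi i (τ i) p -
        ∑ j ∈ Finset.range N, partialXi i (fun p => (ψ p.2 : ℂ) * g j i p) p := by
    intro i
    have hd : ∀ j ∈ Finset.range N,
        DifferentiableAt ℝ (fun p : E n × E n => (ψ p.2 : ℂ) * g j i p) p :=
      fun j _ => differentiableAt_of_contDiffOn hV (hgs i j) hp
    simp only [partialXi]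
    rw [fderiv_fun_sub (hτs i) (DifferentiableAt.fun_sum hd), fderiv_fun_sum hd]
    simp
  simp only [e, Finset.sum_sub_distrib]
  rw [Finset.sum_comm (s := Finset.range N)]
  ring

end

end OddClassSymbol

/-! ### Conclusion: odd-class symbols as divergences -/

open OddClassSymbol in
theorem proposition2p4 {n : ℕ} (hn : Odd n) {U : Set (OddClassSymbol.E n)} (hU : IsOpen U)
    (a : ℤ) (hna : n = 1 → a < -1) (σ : OddClassSymbol.E n × OddClassSymbol.E n → ℂ)
    (hσ : OddClassSymbol.IsOddClass U a σ) :
    ∃ τ : Fin n → OddClassSymbol.E n × OddClassSymbol.E n → ℂ,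
      (∀ i, OddClassSymbol.IsOddClass U (a + 1) (τ i)) ∧
      OddClassSymbol.IsSmoothing U
        (fun p => σ p - ∑ i, OddClassSymbol.partialXi i (τ i) p) := by
  obtain ⟨-, h, hexp, hpar⟩ := hσ
  have hhom : ∀ j : ℕ, IsHomogeneousSymbol U ((a - j : ℤ) : ℂ) (h j) := fun j => by
    have := hexp.component j
    push_cast
    exact this
  choose g hg1 hg2 hg3 using fun j : ℕ => exists_antidivergence hn hU (k := a - j)
    -- For `n = 1`, `a < -1` keeps every degree `a - j` below `-1`.
    (fun h1 => by have := hna h1; omega) (hhom j)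
    fun x hx ξ hξ => (hhom j).parity (hpar j) hx hξ
  have hdeg : ∀ j : ℕ, a - (j : ℤ) + 1 = a + 1 - j := fun j => by ring
  simp only [hdeg] at hg1 hg2
  choose τ hτ using fun i : Fin n =>
    exists_hasClassicalExpansion hU (a + 1) (h := fun j => g j i) fun j => hg1 j i
  obtain ⟨ψ, hψ⟩ := exists_isCutoff n
  refine ⟨τ, fun i => ⟨?_, fun j => g j i, hτ i, fun j x hx ξ hξ => ?_⟩,
    isSmoothing_sub_divergence hU hexp hτ hg3⟩
  -- The remainder after zero terms is `τ i` itself.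
  · simpa using ((hτ i).expansion ψ hψ).remainder 0
  · exact hg2 j i x hx ξ (norm_pos_iff.1 (one_pos.trans_le hξ))
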